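/- Let $\nu$ be a probability measure on $\mathbb{Z}$ with finite fourth moment, mean $\mu$, variance $\sigma^2$ (with $\sigma>0$) and third central moment $\sigma^3\gamma$. Let $S=\{k\in\mathbb{Z}:\nu(\{k\})>0\}$ be its support, and suppose that for some $s_0\in S$ the greatest common divisor of $\{|s-s_0| : s\in S\}$ is $1$. Then there is a constant $C$, depending only on $\nu$, with the following property. Let $n\ge 1$, let $X_1,\dots,X_n$ be independent random variables with common law $\nu$, put $$W=\frac{1}{\sigma\sqrt n}\sum_{i=1}^n (X_i-\mu),$$ and let $Z\sim N(0,1)$. For every (Lebesgue measurable) $h:\mathbb{R}\to\mathbb{R}$ such that $|h(x)|\le 1$ for all $x\in\mathbb{R}$ and such that, for every $z$ in the support of $W$, $h$ is constant (with a constant that may depend on $z$) on the open interval $\left(z-\frac{1}{2\sigma\sqrt n},\,z+\frac{1}{2\sigma\sqrt n}\right)$, one has $$\left|\mathbb{E}\,h(W)-\mathbb{E}\,h(Z)-\frac{\gamma}{6\sqrt n}\,\mathbb{E}\big[(Z^3-3Z)\,h(Z)\big]\right|\le\frac{C}{n}.$$ -/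

import Mathlib

open MeasureTheory ProbabilityTheory

/-- The standardized sum `(1 / (σ √n)) ∑ i, (X i - μ)` of `n` integer-valued random variables. -/
noncomputable def standardizedSum {Ω : Type*} {n : ℕ} (μ σ : ℝ) (X : Fin n → Ω → ℤ) (ω : Ω) : ℝ :=
  1 / (σ * √(n : ℝ)) * ∑ i, ((X i ω : ℝ) - μ)

/-- The function `h` is constant (with a constant depending on `z`) on the open interval
`(z - δ, z + δ)`, for every point `z` of the set `S`. -/
def ConstantAround (h : ℝ → ℝ) (S : Set ℝ) (δ : ℝ) : Prop :=
  ∀ z ∈ S, ∃ c : ℝ, ∀ x ∈ Set.Ioo (z - δ) (z + δ), h x = c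

/-! ### Taylor bounds for characteristic functions -/

section CharFunBounds

open Complex

/-! Let `S` be the sum of the `X i`, `θ = n μ`, `r = σ √n`. The values of `W` are points `(k - θ) /
r`, and the cells of width `1 / r` around all such points tile the line. Since `h` is constant on
the cell of each atom, the claim reduces to an `ℓ¹` comparison, within `O(1/n)`, of `P(S = k)` with
the mass that the signed density `1 + γ (x³ - 3x) / (6√n)` gives to the cell of `k` under the
standard Gaussian.

Both quantities are Fourier integrals. Inversion on the lattice gives `2π P(S = k) = ∫ exp(-i(k-θ)t)
φ(t)^n dt` over `[-π, π]`, with `φ` the characteristic function of `X - μ`. The cell mass is the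
same integral over all of `ℝ` with `φ^n` replaced by `κ G`, where `G` is `edgeworthCharFun` and `κ`
is the characteristic function of the uniform law on a unit cell
(`setIntegral_hermite_gaussianReal`). Since `κ = 1 + O(t²)`, averaging over a cell costs only
`O(1/n)`. Cutting the integral to `[-π, π]` costs `O(n⁻²)` per point, which is affordable over
`O(n)` points.

The gcd condition gives `|φ| < 1` on `[-π, π]` away from `0`, hence `|φ(t)| ≤ exp(-ct²)` there. With
the Taylor expansion of `φ` this bounds `f = φ^n - κ G` by `(C/n) exp(-c'nt²)` and `f'` by `(C/√n)
exp(-c'nt²)` (`exists_edgeworth_bounds`). Bounding each Fourier coefficient of `f` separately and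
summing over `O(n)` points would lose too much. Instead `exists_sum_norm_integral_oscExp_le` applies
Cauchy-Schwarz with weights `n + (k-θ)²`: Parseval for `f` and `f'` controls the weighted square sum
by `O(n^(-3/2))`, and the reciprocal weights sum to `O(n^(-1/2))`.

Two points remain in `abs_integral_sub_integral_le_of_cells`. Outside `|k-θ| ≤ n + 1`, Chebyshev and
a Gaussian moment bound give `O(1/n)`. On the cells of lattice points that are not atoms `h` is
arbitrary, but there the signed density has small mass and its negative part is controlled by its
squared correction, of order `1/n`. -/

lemma norm_le_of_norm_deriv_le_pow {E : Type*} [NormedAddCommGroup E] [NormedSpace ℝ E]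
    {u u' : ℝ → E} {C : ℝ} (hC : 0 ≤ C) {m : ℕ} (hu : ∀ t, HasDerivAt u (u' t) t) (h0 : u 0 = 0)
    (hbound : ∀ t, ‖u' t‖ ≤ C * |t| ^ m) (t : ℝ) : ‖u t‖ ≤ C * |t| ^ (m + 1) := by
  have hconv : Convex ℝ (Set.Icc (-|t|) |t|) := convex_Icc _ _
  have key := hconv.norm_image_sub_le_of_norm_hasDerivWithin_le (f := u) (f' := u')
    (C := C * |t| ^ m) (x := 0) (y := t) (fun x _ => (hu x).hasDerivWithinAt)
    (fun x hx => (hbound x).trans (by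
      have : |x| ≤ |t| := abs_le.2 hx
      gcongr))
    (by simp) ⟨neg_abs_le t, le_abs_self t⟩
  rw [h0, sub_zero, sub_zero, Real.norm_eq_abs] at key
  rwa [pow_succ, ← mul_assoc]

lemma hasDerivAt_cexp_ofReal_mul_I (x : ℝ) :
    HasDerivAt (fun x : ℝ => cexp (x * I)) (I * cexp (x * I)) x := by
  have h := ((hasDerivAt_id x).ofReal_comp.mul_const I).cexp
  simpa [mul_comm] using h

lemma norm_cexp_sub_one_le (x : ℝ) : ‖cexp (x * I) - 1‖ ≤ |x| := by
  have h := norm_le_of_norm_deriv_le_pow (u := fun x : ℝ => cexp (x * I) - 1) zero_le_one (m := 0)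
    (fun t => (hasDerivAt_cexp_ofReal_mul_I t).sub_const 1) (by simp)
    (fun t => by simp [Complex.norm_exp_ofReal_mul_I]) x
  simpa using h

lemma norm_cexp_sub_one_sub_le (x : ℝ) : ‖cexp (x * I) - 1 - x * I‖ ≤ |x| ^ 2 := by
  have h := norm_le_of_norm_deriv_le_pow (u := fun x : ℝ => cexp (x * I) - 1 - x * I) zero_le_one
    (m := 1) (u' := fun x => I * (cexp (x * I) - 1))
    (fun t => (((hasDerivAt_cexp_ofReal_mul_I t).sub_const 1).sub
        ((hasDerivAt_id t).ofReal_comp.mul_const I)).congr_deriv (by push_cast; ring)) (by simp)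
    (fun t => by simpa using norm_cexp_sub_one_le t) x
  simpa using h

lemma norm_cexp_sub_quadratic_le (x : ℝ) :
    ‖cexp (x * I) - 1 - x * I + x ^ 2 / 2‖ ≤ |x| ^ 3 := by
  have h := norm_le_of_norm_deriv_le_pow
    (u := fun x : ℝ => cexp (x * I) - 1 - x * I + x ^ 2 / 2) zero_le_one
    (m := 2) (u' := fun x => I * (cexp (x * I) - 1 - x * I))
    (fun t => ((((hasDerivAt_cexp_ofReal_mul_I t).sub_const 1).sub
        ((hasDerivAt_id t).ofReal_comp.mul_const I)).add
        (((hasDerivAt_id t).ofReal_comp.pow 2).div_const 2)).congr_deriv (by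
          simp only [id, ofReal_one, Nat.cast_ofNat]
          linear_combination (t : ℂ) * I_sq)) (by simp)
    (fun t => by simpa using norm_cexp_sub_one_sub_le t) x
  simpa using h

variable {m : Measure ℝ} [IsProbabilityMeasure m]

lemma integrable_pow_of_le {p q : ℕ} (hpq : p ≤ q) (h : Integrable (fun x : ℝ => x ^ q) m) :
    Integrable (fun x : ℝ => x ^ p) m := by
  have h' : MemLp (id : ℝ → ℝ) q m := by
    rcases Nat.eq_zero_or_pos q with rfl | hq
    · simpa using aestronglyMeasurable_id
    · refine (integrable_norm_rpow_iff aestronglyMeasurable_id (by simpa using hq.ne')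
        (by simp)).1 ?_
      simpa using h.norm
  have := (h'.mono_exponent (p := p) (by exact_mod_cast hpq)).integrable_norm_pow'
  refine (integrable_norm_iff (by fun_prop)).1 ?_
  simpa using this

lemma hasDerivAt_charFun_of_integrable (h1 : Integrable (fun x : ℝ => x) m) (t : ℝ) :
    HasDerivAt (charFun m) (∫ x : ℝ, I * x * cexp ((t * x : ℝ) * I) ∂m) t := by
  have hL : MemLp (id : ℝ → ℝ) (1 : ℕ) m := by
    rw [Nat.cast_one]; exact memLp_one_iff_integrable.2 h1
  have hd : DifferentiableAt ℝ (charFun m) t :=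
    (contDiff_charFun hL).differentiable (by simp) t
  have h := hd.hasDerivAt
  rw [← iteratedDeriv_one, iteratedDeriv_charFun hL, ← integral_const_mul] at h
  refine h.congr_deriv (integral_congr_ae (ae_of_all _ fun x => ?_))
  push_cast
  ring

/-- Because the mean vanishes, `1` may be subtracted from the exponential under the integral, which
gains the factor `|t|`. -/
lemma norm_deriv_charFun_le (h2 : Integrable (fun x : ℝ => x ^ 2) m) (h0 : ∫ x, x ∂m = 0) (t : ℝ) :
    ‖∫ x : ℝ, I * x * cexp ((t * x : ℝ) * I) ∂m‖ ≤ (∫ x, x ^ 2 ∂m) * |t| := by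
  have h1 : Integrable (fun x : ℝ => x) m := by
    simpa using integrable_pow_of_le (p := 1) (by norm_num) h2
  have hI : Integrable (fun x : ℝ => I * x * cexp ((t * x : ℝ) * I)) m := by
    refine h1.mono (by fun_prop) (ae_of_all _ fun x => ?_)
    simp [-ofReal_mul, Complex.norm_exp_ofReal_mul_I]
  have e : ∫ x : ℝ, I * x * cexp ((t * x : ℝ) * I) ∂m
      = ∫ x : ℝ, I * x * (cexp ((t * x : ℝ) * I) - 1) ∂m := by
    have : ∫ x : ℝ, I * (x : ℂ) ∂m = 0 := by
      rw [integral_const_mul, integral_complex_ofReal, h0]; simp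
    simp_rw [mul_sub, mul_one]
    rw [integral_sub hI ((show Integrable (fun x : ℝ => (x : ℂ)) m from h1.ofReal).const_mul I),
      this, sub_zero]
  rw [e, ← integral_mul_const]
  refine norm_integral_le_of_norm_le (h2.mul_const _) (ae_of_all _ fun x => ?_)
  rw [norm_mul, norm_mul, norm_I, one_mul, norm_real, Real.norm_eq_abs]
  calc |x| * ‖cexp ((t * x : ℝ) * I) - 1‖ ≤ |x| * |t * x| := by gcongr; exact norm_cexp_sub_one_le _
    _ = x ^ 2 * |t| := by rw [abs_mul, ← sq_abs x]; ring

lemma norm_charFun_sub_one_le (h2 : Integrable (fun x : ℝ => x ^ 2) m) (h0 : ∫ x, x ∂m = 0)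
    (t : ℝ) : ‖charFun m t - 1‖ ≤ (∫ x, x ^ 2 ∂m) * |t| ^ 2 := by
  have h1 : Integrable (fun x : ℝ => x) m := by
    simpa using integrable_pow_of_le (p := 1) (by norm_num) h2
  exact norm_le_of_norm_deriv_le_pow (u := fun t => charFun m t - 1) (m := 1)
    (integral_nonneg fun x => sq_nonneg x)
    (fun t => (hasDerivAt_charFun_of_integrable h1 t).sub_const 1) (by simp)
    (fun t => by simpa using norm_deriv_charFun_le h2 h0 t) t

lemma norm_deriv_charFun_sub_le (h4 : Integrable (fun x : ℝ => x ^ 4) m) (h0 : ∫ x, x ∂m = 0)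
    (t : ℝ) :
    ‖(∫ x : ℝ, I * x * cexp ((t * x : ℝ) * I) ∂m)
      - (-(∫ x, x ^ 2 ∂m : ℝ) * t - I * (∫ x, x ^ 3 ∂m : ℝ) * t ^ 2 / 2)‖
      ≤ (∫ x, x ^ 4 ∂m) * |t| ^ 3 := by
  have h1 : Integrable (fun x : ℝ => x) m := by
    simpa using integrable_pow_of_le (p := 1) (by norm_num) h4
  have h2 := integrable_pow_of_le (p := 2) (by norm_num) h4
  have h3 := integrable_pow_of_le (p := 3) (by norm_num) h4
  have hI : Integrable (fun x : ℝ => I * x * cexp ((t * x : ℝ) * I)) m := by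
    refine h1.mono (by fun_prop) (ae_of_all _ fun x => ?_)
    simp [-ofReal_mul, Complex.norm_exp_ofReal_mul_I]
  have e : (∫ x : ℝ, I * x * cexp ((t * x : ℝ) * I) ∂m)
      - (-(∫ x, x ^ 2 ∂m : ℝ) * t - I * (∫ x, x ^ 3 ∂m : ℝ) * t ^ 2 / 2)
      = ∫ x : ℝ, I * x * (cexp ((t * x : ℝ) * I) - 1 - (t * x : ℝ) * I
        + ((t * x : ℝ) : ℂ) ^ 2 / 2) ∂m := by
    have e2 : ∫ x : ℝ, ((x ^ 2 : ℝ) : ℂ) ∂m = (∫ x, x ^ 2 ∂m : ℝ) := integral_complex_ofReal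
    have e3 : ∫ x : ℝ, ((x ^ 3 : ℝ) : ℂ) ∂m = (∫ x, x ^ 3 ∂m : ℝ) := integral_complex_ofReal
    have e1 : ∫ x : ℝ, (x : ℂ) ∂m = 0 := by rw [integral_complex_ofReal, h0]; simp
    have h1c : Integrable (fun x : ℝ => (x : ℂ)) m := h1.ofReal
    have h2c : Integrable (fun x : ℝ => ((x ^ 2 : ℝ) : ℂ)) m := h2.ofReal
    have h3c : Integrable (fun x : ℝ => ((x ^ 3 : ℝ) : ℂ)) m := h3.ofReal
    have hfun : (fun x : ℝ => I * x * (cexp ((t * x : ℝ) * I) - 1 - (t * x : ℝ) * I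
        + ((t * x : ℝ) : ℂ) ^ 2 / 2)) = fun x : ℝ => I * x * cexp ((t * x : ℝ) * I) - I * (x : ℂ)
          + t * ((x ^ 2 : ℝ) : ℂ) + (I * t ^ 2 / 2) * ((x ^ 3 : ℝ) : ℂ) := by
      funext x
      push_cast
      linear_combination (-(t : ℂ) * x ^ 2) * I_sq
    rw [hfun, integral_add, integral_add, integral_sub, integral_const_mul, integral_const_mul,
      integral_const_mul, e1, e2, e3]
    · ring
    · exact hI
    · exact h1c.const_mul _
    · exact hI.sub (h1c.const_mul _)
    · exact h2c.const_mul _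
    · exact (hI.sub (h1c.const_mul _)).add (h2c.const_mul _)
    · exact h3c.const_mul _
  rw [e, ← integral_mul_const]
  refine norm_integral_le_of_norm_le (h4.mul_const _) (ae_of_all _ fun x => ?_)
  rw [norm_mul, norm_mul, norm_I, one_mul, norm_real, Real.norm_eq_abs]
  calc _ ≤ |x| * |t * x| ^ 3 := by gcongr; exact norm_cexp_sub_quadratic_le _
    _ = x ^ 4 * |t| ^ 3 := by rw [abs_mul, ← Even.pow_abs (by decide : Even 4) x]; ring

lemma norm_charFun_sub_le (h4 : Integrable (fun x : ℝ => x ^ 4) m) (h0 : ∫ x, x ∂m = 0)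
    (t : ℝ) :
    ‖charFun m t - (1 - (∫ x, x ^ 2 ∂m : ℝ) * t ^ 2 / 2 - I * (∫ x, x ^ 3 ∂m : ℝ) * t ^ 3 / 6)‖
      ≤ (∫ x, x ^ 4 ∂m) * |t| ^ 4 := by
  have h1 : Integrable (fun x : ℝ => x) m := by
    simpa using integrable_pow_of_le (p := 1) (by norm_num) h4
  refine norm_le_of_norm_deriv_le_pow (m := 3) (u := fun t : ℝ => charFun m t -
    (1 - (∫ x, x ^ 2 ∂m : ℝ) * t ^ 2 / 2 - I * (∫ x, x ^ 3 ∂m : ℝ) * t ^ 3 / 6)) (integral_nonneg fun x => by positivity)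
    (fun t => ?_) (by simp) (norm_deriv_charFun_sub_le h4 h0) t
  refine (hasDerivAt_charFun_of_integrable h1 t).sub ?_
  refine ((((((hasDerivAt_id t).ofReal_comp.pow 2).const_mul
    ((∫ x, x ^ 2 ∂m : ℝ) : ℂ)).div_const 2).const_sub 1).sub
    ((((hasDerivAt_id t).ofReal_comp.pow 3).const_mul
    (I * (∫ x, x ^ 3 ∂m : ℝ))).div_const 6)).congr_deriv ?_
  simp only [id, ofReal_one, Nat.cast_ofNat]
  ring

end CharFunBounds

/-! ### Lattice span one and Gaussian decay of the characteristic function -/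

section CharFunDecay

open Complex

/-- The integers `d` with `t d ∈ 2πℤ` form an ideal, and an ideal containing a set of gcd `1`
contains `1`. -/
lemma exists_int_mul_two_pi_of_setGcd_eq_one {s : Set ℕ} (hs : Nat.setGcd s = 1) {t : ℝ}
    (h : ∀ d ∈ s, ∃ m : ℤ, t * d = m * (2 * Real.pi)) : ∃ m : ℤ, t = m * (2 * Real.pi) := by
  have hone : (1 : ℤ) ∈ Ideal.span (((↑) : ℕ → ℤ) '' s) := by
    rw [← Nat.span_singleton_setGcd, hs]
    exact Ideal.mem_span_singleton_self _
  have key : ∀ d ∈ Ideal.span (((↑) : ℕ → ℤ) '' s), ∃ m : ℤ, t * (d : ℤ) = m * (2 * Real.pi) := by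
    intro d hd
    induction hd using Submodule.span_induction with
    | mem x hx =>
      obtain ⟨k, hk, rfl⟩ := hx
      simpa using h k hk
    | zero => exact ⟨0, by simp⟩
    | add x y _ _ hx hy =>
      obtain ⟨a, ha⟩ := hx
      obtain ⟨b, hb⟩ := hy
      exact ⟨a + b, by push_cast; rw [mul_add, ha, hb]; ring⟩
    | smul c x _ hx =>
      obtain ⟨a, ha⟩ := hx
      exact ⟨c * a, by rw [smul_eq_mul]; push_cast; rw [mul_left_comm, ha]; ring⟩
  obtain ⟨m, hm⟩ := key 1 hone
  exact ⟨m, by simpa using hm⟩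

lemma mem_support_iff_singleton_ne_zero {ν : Measure ℤ} {s : ℤ} :
    s ∈ ν.support ↔ ν {s} ≠ 0 := by
  rw [Measure.mem_support_iff_forall]
  refine ⟨fun h => (h {s} (by simp)).ne', fun h U hU => ?_⟩
  exact (pos_iff_ne_zero.2 h).trans_le
    (measure_mono (Set.singleton_subset_iff.2 (mem_of_mem_nhds hU)))

/-- Equality in the triangle inequality would make the unimodular integrand constant on the support.
Then `t (s - s₀) ∈ 2πℤ` for every `s` in the support, so `t ∈ 2πℤ`, which `0 < |t| ≤ π` excludes. -/
lemma norm_charFun_lt_one_of_setGcd_eq_one {ν : Measure ℤ} [IsProbabilityMeasure ν] (μ : ℝ) {s₀ : ℤ}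
    (hs₀ : s₀ ∈ ν.support)
    (hgcd : Nat.setGcd {d : ℕ | ∃ s ∈ ν.support, d = (s - s₀).natAbs} = 1)
    {t : ℝ} (ht : t ≠ 0) (htpi : |t| ≤ Real.pi) :
    ‖charFun (ν.map fun k : ℤ => (k : ℝ) - μ) t‖ < 1 := by
  rw [charFun_apply_real, integral_map (by fun_prop) (by fun_prop)]
  set f : ℤ → ℂ := fun k => cexp (t * ((k : ℝ) - μ : ℝ) * I) with hf
  have hnorm : ∀ k, ‖f k‖ = 1 := fun k => by
    simp only [hf]; rw [← ofReal_mul, norm_exp_ofReal_mul_I]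
  rcases ae_eq_const_or_norm_integral_lt_of_norm_le_const (μ := ν) (f := f) (C := 1)
    (ae_of_all _ fun k => (hnorm k).le) with h | h
  · exfalso
    set w := ⨍ x, f x ∂ν
    have hsupp : ∀ s ∈ ν.support, f s = w := by
      intro s hs
      by_contra hne
      refine mem_support_iff_singleton_ne_zero.1 hs (measure_mono_null ?_ (ae_iff.1 h))
      simpa using hne
    obtain ⟨m, hm⟩ := exists_int_mul_two_pi_of_setGcd_eq_one hgcd (t := t) (by
      rintro d ⟨s, hs, rfl⟩
      have he : cexp ((t * (s - s₀ : ℤ) : ℝ) * I) = 1 := by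
        have h1 : f s = cexp ((t * (s - s₀ : ℤ) : ℝ) * I) * f s₀ := by
          simp only [hf]
          rw [← Complex.exp_add]
          congr 1
          push_cast
          ring
        rw [hsupp s hs, hsupp s₀ hs₀] at h1
        have hw : w ≠ 0 := by
          rw [← hsupp s hs, ← norm_ne_zero_iff, hnorm]; norm_num
        exact mul_right_cancel₀ hw (by rw [← h1, one_mul])
      obtain ⟨m, hm⟩ := Complex.exp_eq_one_iff.1 he
      have hm' : t * (s - s₀ : ℤ) = m * (2 * Real.pi) := by
        have : ((t * (s - s₀ : ℤ) : ℝ) : ℂ) = ((m * (2 * Real.pi) : ℝ) : ℂ) := by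
          apply mul_right_cancel₀ I_ne_zero
          rw [hm]; push_cast; ring
        exact_mod_cast this
      rw [Nat.cast_natAbs]
      rcases abs_choice (s - s₀) with h2 | h2
      · exact ⟨m, by rw [h2, hm']⟩
      · exact ⟨-m, by rw [h2, Int.cast_neg, mul_neg, hm']; push_cast; ring⟩)
    have hm0 : m = 0 := by
      have hpi := Real.pi_pos
      rw [hm, abs_mul, abs_of_pos (by positivity : 0 < 2 * Real.pi)] at htpi
      have h1 : |(m : ℝ)| < 1 := by nlinarith
      have h2 : |m| < 1 := by exact_mod_cast h1
      exact Int.abs_lt_one_iff.1 h2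
    exact ht (by rw [hm, hm0]; simp)
  · simpa using h

/-- Near `0` the bound comes from the Taylor expansion; on the remaining compact set the maximum of
the modulus is below `1`, and a small enough rate `c` suffices. -/
lemma exists_norm_charFun_le_exp {m : Measure ℝ} [IsProbabilityMeasure m]
    (h4 : Integrable (fun x : ℝ => x ^ 4) m) (h0 : ∫ x, x ∂m = 0) (h2 : 0 < ∫ x, x ^ 2 ∂m) {R : ℝ}
    (hlt : ∀ t, t ≠ 0 → |t| ≤ R → ‖charFun m t‖ < 1) :
    ∃ c > 0, ∀ t, |t| ≤ R → ‖charFun m t‖ ≤ Real.exp (-c * t ^ 2) := by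
  set b := ∫ x, x ^ 2 ∂m
  set k3 := ∫ x, x ^ 3 ∂m
  set k4 := ∫ x, x ^ 4 ∂m
  have hk4 : 0 ≤ k4 := integral_nonneg fun x => by positivity
  set A := |k3| + k4 + 1 with hA
  have hApos : 0 < A := by positivity
  -- The second entry makes the cubic and quartic terms at most `b t² / 4`; the third keeps `1 - b
  -- t² / 2` nonnegative, so that it equals its modulus.
  set ε := min 1 (min (b / (4 * A)) (1 / (b + 1))) with hε
  have hεpos : 0 < ε := by positivity
  have hε1 : ε ≤ 1 := min_le_left _ _
  have hε2 : ε * (4 * A) ≤ b := by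
    have : ε ≤ b / (4 * A) := (min_le_right _ _).trans (min_le_left _ _)
    rwa [le_div_iff₀ (by positivity)] at this
  have hε3 : ε * (b + 1) ≤ 1 := by
    have : ε ≤ 1 / (b + 1) := (min_le_right _ _).trans (min_le_right _ _)
    rwa [le_div_iff₀ (by positivity)] at this
  have hnear : ∀ t, |t| ≤ ε → ‖charFun m t‖ ≤ Real.exp (-(b / 4) * t ^ 2) := by
    intro t ht
    have ht0 := abs_nonneg t
    have hsub := norm_charFun_sub_le h4 h0 t
    have hb1 : b * |t| ^ 2 / 2 ≤ 1 := by
      have : |t| ^ 2 ≤ ε * 1 := by nlinarith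
      nlinarith
    have h1 : ‖(1 - (b : ℂ) * t ^ 2 / 2 - I * (k3 : ℂ) * t ^ 3 / 6)‖
        ≤ (1 - b * |t| ^ 2 / 2) + |k3| * |t| ^ 3 := by
      refine (norm_sub_le _ _).trans (add_le_add ?_ ?_)
      · have : (1 - (b : ℂ) * t ^ 2 / 2) = ((1 - b * |t| ^ 2 / 2 : ℝ) : ℂ) := by
          rw [sq_abs]; push_cast; ring
        rw [this, norm_real, Real.norm_eq_abs, abs_of_nonneg (by linarith)]
      · simp only [norm_div, norm_mul, norm_I, norm_real, norm_pow, Real.norm_eq_abs, one_mul]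
        have : 0 ≤ |k3| * |t| ^ 3 := by positivity
        norm_num
        linarith
    have h3 : ‖charFun m t‖ ≤ 1 - b * |t| ^ 2 / 2 + |k3| * |t| ^ 3 + k4 * |t| ^ 4 := by
      have := norm_le_norm_sub_add (charFun m t)
        (1 - (b : ℂ) * t ^ 2 / 2 - I * (k3 : ℂ) * t ^ 3 / 6)
      linarith
    have h5 : |k3| * |t| ^ 3 + k4 * |t| ^ 4 ≤ b / 4 * |t| ^ 2 := by
      have e1 : |k3| * |t| + k4 * |t| ^ 2 ≤ A * ε := by
        have : |t| ^ 2 ≤ ε := by nlinarith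
        have h6 : |k3| * |t| ≤ |k3| * ε := by gcongr
        have h7 : k4 * |t| ^ 2 ≤ k4 * ε := by gcongr
        rw [hA]; nlinarith
      nlinarith [sq_nonneg |t|]
    have h6 := Real.add_one_le_exp (-(b / 4) * t ^ 2)
    rw [← sq_abs t] at h6 ⊢
    linarith
  have hcomp : IsCompact {t : ℝ | ε ≤ |t| ∧ |t| ≤ R} := by
    refine (isCompact_Icc (a := -R) (b := R)).of_isClosed_subset ?_ fun t ht => abs_le.1 ht.2
    exact (isClosed_le continuous_const continuous_abs).inter
      (isClosed_le continuous_abs continuous_const)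
  rcases Set.eq_empty_or_nonempty {t : ℝ | ε ≤ |t| ∧ |t| ≤ R} with hemp | hne
  · refine ⟨b / 4, by positivity, fun t ht => hnear t ?_⟩
    by_contra hcon
    exact (Set.eq_empty_iff_forall_notMem.1 hemp t) ⟨(not_le.1 hcon).le, ht⟩
  obtain ⟨t₀, ht₀, hmax⟩ := hcomp.exists_isMaxOn hne
    (continuous_charFun (μ := m)).norm.continuousOn
  have hRpos : 0 < R := hεpos.trans_le (ht₀.1.trans ht₀.2)
  -- The value `1 / 2` only keeps `q` positive, so that `exp (log q) = q`.
  set q := max ‖charFun m t₀‖ (1 / 2) with hq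
  have hqpos : 0 < q := by positivity
  have hq1 : q < 1 := max_lt (hlt t₀ (fun h => by
    have := ht₀.1; rw [h, abs_zero] at this; linarith) ht₀.2) (by norm_num)
  have hlog : Real.log q < 0 := Real.log_neg hqpos hq1
  refine ⟨min (b / 4) (-Real.log q / R ^ 2), lt_min (by positivity)
    (div_pos (by linarith) (by positivity)), fun t ht => ?_⟩
  rcases le_total |t| ε with hcase | hcase
  · refine (hnear t hcase).trans (Real.exp_le_exp.2 ?_)
    have := min_le_left (b / 4) (-Real.log q / R ^ 2)
    nlinarith [sq_nonneg t]
  · have h1 : ‖charFun m t‖ ≤ q := (hmax ⟨hcase, ht⟩).trans (le_max_left _ _)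
    refine h1.trans ?_
    rw [← Real.log_le_iff_le_exp hqpos]
    have h2 := min_le_right (b / 4) (-Real.log q / R ^ 2)
    have h3 : t ^ 2 ≤ R ^ 2 := by rw [← sq_abs t]; gcongr
    have h4 : min (b / 4) (-Real.log q / R ^ 2) * t ^ 2 ≤ -Real.log q / R ^ 2 * R ^ 2 := by
      have : 0 ≤ -Real.log q / R ^ 2 := div_nonneg (by linarith) (by positivity)
      gcongr
    rw [div_mul_cancel₀ _ (by positivity)] at h4
    linarith

end CharFunDecay

/-! ### Comparing the `n`-th power with the Edgeworth transform -/

section EdgeworthCharFun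

open Complex

/-- The Fourier transform of the Edgeworth approximation of order one, for a sum of `n` terms of
variance `b` and third central moment `6 * α`. -/
noncomputable def edgeworthCharFun (b α : ℝ) (n : ℕ) (t : ℝ) : ℂ :=
  (Real.exp (-(n * b * t ^ 2 / 2)) : ℂ) * (1 - I * n * α * t ^ 3)

/-- The derivative of `edgeworthCharFun`. -/
noncomputable def edgeworthCharFunDeriv (b α : ℝ) (n : ℕ) (t : ℝ) : ℂ :=
  -(n * b * t) * edgeworthCharFun b α n t
    - (Real.exp (-(n * b * t ^ 2 / 2)) : ℂ) * (3 * I * n * α * t ^ 2)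

lemma hasDerivAt_edgeworthCharFun (b α : ℝ) (n : ℕ) (t : ℝ) :
    HasDerivAt (edgeworthCharFun b α n) (edgeworthCharFunDeriv b α n t) t := by
  have h1 : HasDerivAt (fun t : ℝ => (Real.exp (-(n * b * t ^ 2 / 2)) : ℂ))
      (((Real.exp (-(n * b * t ^ 2 / 2)) * -(n * b * (2 * t) / 2) : ℝ)) : ℂ) t := by
    have := (((((hasDerivAt_id t).pow 2).const_mul (n * b)).div_const 2).neg.exp)
    exact (this.congr_deriv (by simp)).ofReal_comp
  have h2 : HasDerivAt (fun t : ℝ => (1 - I * n * α * t ^ 3 : ℂ)) (-(I * n * α * (3 * t ^ 2))) t := by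
    have := (((hasDerivAt_id t).ofReal_comp.pow 3).const_mul (I * n * α)).const_sub 1
    exact this.congr_deriv (by simp)
  refine (h1.mul h2).congr_deriv ?_
  simp only [edgeworthCharFunDeriv, edgeworthCharFun]
  push_cast
  ring

lemma continuous_edgeworthCharFun (b α : ℝ) (n : ℕ) : Continuous (edgeworthCharFun b α n) :=
  continuous_iff_continuousAt.2 fun t => (hasDerivAt_edgeworthCharFun b α n t).continuousAt

lemma continuous_edgeworthCharFunDeriv (b α : ℝ) (n : ℕ) :
    Continuous (edgeworthCharFunDeriv b α n) := by
  have := continuous_edgeworthCharFun b α n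
  unfold edgeworthCharFunDeriv
  fun_prop

lemma norm_one_sub_I_mul_cube_le (α : ℝ) (n : ℕ) (t : ℝ) :
    ‖(1 - I * n * α * t ^ 3 : ℂ)‖ ≤ 1 + n * |α| * |t| ^ 3 := by
  refine (norm_sub_le _ _).trans ?_
  simp

lemma norm_edgeworthCharFun_le (b α : ℝ) (n : ℕ) (t : ℝ) :
    ‖edgeworthCharFun b α n t‖
      ≤ Real.exp (-(n * b * t ^ 2 / 2)) * (1 + n * |α| * |t| ^ 3) := by
  rw [edgeworthCharFun, norm_mul, norm_real, Real.norm_of_nonneg (Real.exp_pos _).le]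
  gcongr
  exact norm_one_sub_I_mul_cube_le α n t

/-- The exponential of the third order Taylor polynomial of the cumulant generating function. -/
noncomputable def cumulantExp (b α t : ℝ) : ℂ := cexp (-(b * t ^ 2 / 2) - I * α * t ^ 3)

lemma cumulantExp_pow (b α : ℝ) (n : ℕ) (t : ℝ) :
    cumulantExp b α t ^ n
      = (Real.exp (-(n * b * t ^ 2 / 2)) : ℂ) * cexp ((-(n * α * t ^ 3) : ℝ) * I) := by
  rw [cumulantExp, ← Complex.exp_nat_mul, ofReal_exp, ← Complex.exp_add]
  congr 1
  push_cast
  ring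

lemma norm_cumulantExp (b α t : ℝ) : ‖cumulantExp b α t‖ = Real.exp (-(b * t ^ 2 / 2)) := by
  have := cumulantExp_pow b α 1 t
  rw [pow_one] at this
  rw [this, norm_mul, norm_exp_ofReal_mul_I, norm_real, Real.norm_of_nonneg (Real.exp_pos _).le]
  simp

/-- Both functions share the third order Taylor polynomial. The factor multiplying `cumulantExp` in
the second bound is the derivative of its exponent. Restricting to `|t| ≤ R` bounds the exponential
remainder factor. -/
lemma exists_norm_sub_cumulantExp_le {φ φ' : ℝ → ℂ} {b α k R : ℝ} (hb : 0 ≤ b) (hk : 0 ≤ k)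
    (hR : 0 ≤ R)
    (h : ∀ t : ℝ, ‖φ t - (1 - b * t ^ 2 / 2 - I * α * t ^ 3)‖ ≤ k * |t| ^ 4)
    (h' : ∀ t : ℝ, ‖φ' t - (-b * t - 3 * I * α * t ^ 2)‖ ≤ k * |t| ^ 3) :
    ∃ M, 0 ≤ M ∧ ∀ t, |t| ≤ R → ‖φ t - cumulantExp b α t‖ ≤ M * |t| ^ 4 ∧
      ‖φ' t - (-b * t - 3 * I * α * t ^ 2) * cumulantExp b α t‖ ≤ M * |t| ^ 3 := by
  set Q := b + 3 * |α| * R with hQ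
  have hQ0 : 0 ≤ Q := by positivity
  refine ⟨k + Q ^ 2 * Real.exp (Q * R ^ 2), by positivity, fun t ht => ?_⟩
  have ht0 := abs_nonneg t
  set q : ℂ := -(b * t ^ 2 / 2) - I * α * t ^ 3 with hq
  have hqn : ‖q‖ ≤ Q * |t| ^ 2 := by
    have h1 : ‖q‖ ≤ b * |t| ^ 2 / 2 + |α| * |t| ^ 3 := by
      refine (norm_sub_le _ _).trans (le_of_eq ?_)
      simp [abs_of_nonneg hb]
    have h2 : |α| * |t| ^ 3 ≤ |α| * R * |t| ^ 2 := by
      have : |α| * |t| ^ 3 = |α| * |t| * |t| ^ 2 := by ring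
      rw [this]; gcongr
    have h3 : 0 ≤ |α| * R * |t| ^ 2 := by positivity
    have h4 : 0 ≤ b * |t| ^ 2 := by positivity
    rw [hQ]; linarith
  have hexp : Real.exp ‖q‖ ≤ Real.exp (Q * R ^ 2) := by
    refine Real.exp_le_exp.2 (hqn.trans ?_)
    gcongr
  constructor
  · have e : φ t - cumulantExp b α t
        = (φ t - (1 - b * t ^ 2 / 2 - I * α * t ^ 3)) - (cexp q - (1 + q)) := by
      rw [cumulantExp, ← hq, hq]; ring
    have h2 : ‖cexp q - (1 + q)‖ ≤ ‖q‖ ^ 2 * Real.exp ‖q‖ := by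
      simpa [Finset.sum_range_succ] using norm_exp_sub_sum_le_norm_mul_exp q 2
    rw [e]
    calc _ ≤ k * |t| ^ 4 + (Q * |t| ^ 2) ^ 2 * Real.exp (Q * R ^ 2) := by
          refine (norm_sub_le _ _).trans (add_le_add (h t) (h2.trans ?_))
          gcongr
      _ = _ := by ring
  · have e : φ' t - (-b * t - 3 * I * α * t ^ 2) * cumulantExp b α t
        = (φ' t - (-b * t - 3 * I * α * t ^ 2))
          - (-b * t - 3 * I * α * t ^ 2) * (cexp q - 1) := by
      rw [cumulantExp, ← hq]; ring
    have h2 : ‖cexp q - 1‖ ≤ ‖q‖ * Real.exp ‖q‖ := by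
      simpa [Finset.sum_range_succ] using norm_exp_sub_sum_le_norm_mul_exp q 1
    have h3 : ‖(-b * t - 3 * I * α * t ^ 2 : ℂ)‖ ≤ Q * |t| := by
      calc _ ≤ b * |t| + 3 * |α| * |t| ^ 2 := by
            refine (norm_sub_le _ _).trans (le_of_eq ?_)
            simp [abs_of_nonneg hb]
        _ ≤ b * |t| + 3 * |α| * (R * |t|) := by rw [sq |t|]; gcongr
        _ = _ := by rw [hQ]; ring
    rw [e]
    calc _ ≤ k * |t| ^ 3 + Q * |t| * ((Q * |t| ^ 2) * Real.exp (Q * R ^ 2)) := by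
          refine (norm_sub_le _ _).trans (add_le_add (h' t) ?_)
          rw [norm_mul]
          refine mul_le_mul h3 (h2.trans ?_) (norm_nonneg _) (by positivity)
          gcongr
      _ = _ := by ring

lemma norm_cumulantExp_pow_sub_le (b α : ℝ) (n : ℕ) (t : ℝ) :
    ‖cumulantExp b α t ^ n - (Real.exp (-(n * b * t ^ 2 / 2)) : ℂ)‖
      ≤ Real.exp (-(n * b * t ^ 2 / 2)) * (n * |α| * |t| ^ 3) := by
  have e : cumulantExp b α t ^ n - (Real.exp (-(n * b * t ^ 2 / 2)) : ℂ)
      = (Real.exp (-(n * b * t ^ 2 / 2)) : ℂ) * (cexp ((-(n * α * t ^ 3) : ℝ) * I) - 1) := by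
    rw [cumulantExp_pow]; ring
  rw [e, norm_mul, norm_real, Real.norm_of_nonneg (Real.exp_pos _).le]
  refine mul_le_mul_of_nonneg_left ((norm_cexp_sub_one_le _).trans (le_of_eq ?_))
    (Real.exp_pos _).le
  simp [abs_mul]

lemma norm_cumulantExp_pow_sub_edgeworthCharFun_le (b α : ℝ) (n : ℕ) (t : ℝ) :
    ‖cumulantExp b α t ^ n - edgeworthCharFun b α n t‖
      ≤ Real.exp (-(n * b * t ^ 2 / 2)) * (n * |α| * |t| ^ 3) ^ 2 := by
  have e : cumulantExp b α t ^ n - edgeworthCharFun b α n t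
      = (Real.exp (-(n * b * t ^ 2 / 2)) : ℂ) *
        (cexp ((-(n * α * t ^ 3) : ℝ) * I) - 1 - (-(n * α * t ^ 3) : ℝ) * I) := by
    rw [cumulantExp_pow, edgeworthCharFun]; push_cast; ring
  rw [e, norm_mul, norm_real, Real.norm_of_nonneg (Real.exp_pos _).le]
  refine mul_le_mul_of_nonneg_left ((norm_cexp_sub_one_sub_le _).trans (le_of_eq ?_))
    (Real.exp_pos _).le
  simp [abs_mul]

lemma norm_pow_sub_pow_le_mul {x y : ℂ} {E : ℝ} (hx : ‖x‖ ≤ E) (hy : ‖y‖ ≤ E) (m : ℕ) :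
    ‖x ^ m - y ^ m‖ ≤ m * E ^ (m - 1) * ‖x - y‖ := by
  have hE : 0 ≤ E := (norm_nonneg x).trans hx
  induction m with
  | zero => simp
  | succ m ih =>
    have e : x ^ (m + 1) - y ^ (m + 1) = x ^ m * (x - y) + (x ^ m - y ^ m) * y := by ring
    rw [e]
    calc _ ≤ E ^ m * ‖x - y‖ + (m * E ^ (m - 1) * ‖x - y‖) * E := by
          refine (norm_add_le _ _).trans (add_le_add ?_ ?_)
          · rw [norm_mul, norm_pow]; gcongr
          · rw [norm_mul]; gcongr
      _ = _ := by
          rcases m with _ | m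
          · simp
          · simp only [Nat.add_sub_cancel]; push_cast; ring

/-- Three errors: replacing `x` by `cumulantExp` inside the power, linearizing the cubic exponent,
and replacing `k` by `1`. The factor `exp (2 c R²)` pays for powers such as `n - 1` in place of `n`;
two missing factors are allowed for, as the derivative estimate needs. -/
lemma norm_pow_sub_mul_edgeworthCharFun_le {x k : ℂ} {b α c M R : ℝ} (hc : 0 ≤ c) (hcb : c ≤ b / 2)
    (hM : 0 ≤ M) {n : ℕ} {t : ℝ} (ht : |t| ≤ R)
    (hx : ‖x‖ ≤ Real.exp (-c * t ^ 2)) (hxw : ‖x - cumulantExp b α t‖ ≤ M * |t| ^ 4)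
    (hk : ‖k - 1‖ ≤ M * |t| ^ 2) :
    ‖x ^ n - k * edgeworthCharFun b α n t‖ ≤ Real.exp (-c * (n * t ^ 2)) *
      (Real.exp (2 * c * R ^ 2) * M * n * |t| ^ 4 + (n * |α| * |t| ^ 3) ^ 2
        + M * |t| ^ 2 * (1 + n * |α| * |t| ^ 3)) := by
  have ht2 : t ^ 2 ≤ R ^ 2 := by rw [← sq_abs t]; gcongr
  have hw : ‖cumulantExp b α t‖ ≤ Real.exp (-c * t ^ 2) := by
    rw [norm_cumulantExp]
    refine Real.exp_le_exp.2 ?_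
    nlinarith [sq_nonneg t]
  have he : Real.exp (-(n * b * t ^ 2 / 2)) ≤ Real.exp (-c * (n * t ^ 2)) := by
    refine Real.exp_le_exp.2 ?_
    have : 0 ≤ (n : ℝ) * t ^ 2 := by positivity
    nlinarith
  have hpow : n * Real.exp (-c * t ^ 2) ^ (n - 1)
      ≤ n * (Real.exp (2 * c * R ^ 2) * Real.exp (-c * (n * t ^ 2))) := by
    rcases n with _ | m
    · simp
    gcongr
    rw [← Real.exp_nat_mul, ← Real.exp_add, Nat.add_sub_cancel]
    refine Real.exp_le_exp.2 ?_
    push_cast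
    nlinarith [mul_nonneg hc (sub_nonneg.2 ht2), mul_nonneg hc (sq_nonneg R)]
  have h1 := norm_pow_sub_pow_le_mul hx hw n
  have h2 := norm_cumulantExp_pow_sub_edgeworthCharFun_le b α n t
  have h3 := norm_edgeworthCharFun_le b α n t
  have e : x ^ n - k * edgeworthCharFun b α n t = (x ^ n - cumulantExp b α t ^ n)
      + (cumulantExp b α t ^ n - edgeworthCharFun b α n t)
      + (1 - k) * edgeworthCharFun b α n t := by ring
  rw [e]
  calc _ ≤ n * (Real.exp (2 * c * R ^ 2) * Real.exp (-c * (n * t ^ 2))) * (M * |t| ^ 4)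
        + Real.exp (-c * (n * t ^ 2)) * (n * |α| * |t| ^ 3) ^ 2
        + M * |t| ^ 2 * (Real.exp (-c * (n * t ^ 2)) * (1 + n * |α| * |t| ^ 3)) := by
        refine norm_add₃_le.trans (add_le_add (add_le_add ?_ ?_) ?_)
        · refine h1.trans ?_
          gcongr
        · refine h2.trans ?_
          gcongr
        · rw [norm_mul, norm_sub_rev]
          refine mul_le_mul hk (h3.trans ?_) (norm_nonneg _) (by positivity)
          gcongr
    _ = _ := by ring

lemma norm_deriv_pow_sub_mul_edgeworthCharFun_le {x x' k k' : ℂ} {b α c M R : ℝ} (hc : 0 ≤ c)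
    (hcb : c ≤ b / 2) (hM : 0 ≤ M) {n : ℕ} {t : ℝ} (ht : |t| ≤ R)
    (hx : ‖x‖ ≤ Real.exp (-c * t ^ 2)) (hxw : ‖x - cumulantExp b α t‖ ≤ M * |t| ^ 4)
    (hx' : ‖x'‖ ≤ M * |t|)
    (hxw' : ‖x' - (-b * t - 3 * I * α * t ^ 2) * cumulantExp b α t‖ ≤ M * |t| ^ 3)
    (hk : ‖k - 1‖ ≤ M * |t| ^ 2) (hk' : ‖k'‖ ≤ M * |t|) :
    ‖n * x ^ (n - 1) * x'
        - (k' * edgeworthCharFun b α n t + k * edgeworthCharFunDeriv b α n t)‖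
      ≤ Real.exp (-c * (n * t ^ 2)) *
      (Real.exp (2 * c * R ^ 2) * M ^ 2 * n ^ 2 * |t| ^ 5 + Real.exp (2 * c * R ^ 2) * M * n * |t| ^ 3
        + n * b * |t| * (n * |α| * |t| ^ 3) ^ 2 + 3 * n * |α| * |t| ^ 2 * (n * |α| * |t| ^ 3)
        + M * |t| ^ 2 * (n * b * |t| * (1 + n * |α| * |t| ^ 3) + 3 * n * |α| * |t| ^ 2)
        + M * |t| * (1 + n * |α| * |t| ^ 3)) := by
  have hb : 0 ≤ b := by linarith
  have ht2 : t ^ 2 ≤ R ^ 2 := by rw [← sq_abs t]; gcongr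
  set w := cumulantExp b α t with hwdef
  set e₀ := Real.exp (-(n * b * t ^ 2 / 2)) with he₀
  set g := Real.exp (-c * (n * t ^ 2)) with hg
  set A := Real.exp (2 * c * R ^ 2) with hA
  set G := edgeworthCharFun b α n t with hG
  have hw : ‖w‖ ≤ Real.exp (-c * t ^ 2) := by
    rw [norm_cumulantExp]
    refine Real.exp_le_exp.2 ?_
    nlinarith [sq_nonneg t]
  have he : e₀ ≤ g := by
    refine Real.exp_le_exp.2 ?_
    have : 0 ≤ (n : ℝ) * t ^ 2 := by positivity
    nlinarith
  have he0 : 0 ≤ e₀ := (Real.exp_pos _).le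
  have hpow : n * Real.exp (-c * t ^ 2) ^ (n - 1) ≤ n * (A * g) := by
    rcases n with _ | m
    · simp
    rw [hA, hg]
    gcongr
    rw [← Real.exp_nat_mul, ← Real.exp_add, Nat.add_sub_cancel]
    refine Real.exp_le_exp.2 ?_
    push_cast
    nlinarith [mul_nonneg hc (sub_nonneg.2 ht2), mul_nonneg hc (sq_nonneg R)]
  -- For `n = 1` the exponent truncates, but the coefficient `n - 1` is then `0`.
  have hpow2 : ((n - 1 : ℕ) : ℝ) * Real.exp (-c * t ^ 2) ^ (n - 1 - 1) ≤ n * (A * g) := by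
    rcases n with _ | _ | m
    · simp
    · simp; positivity
    rw [hA, hg]
    have : (m + 1 + 1 - 1 - 1 : ℕ) = m := by omega
    rw [this]
    have h1 : ((m + 1 + 1 - 1 : ℕ) : ℝ) ≤ ((m + 1 + 1 : ℕ) : ℝ) := by
      exact_mod_cast Nat.sub_le _ _
    gcongr
    rw [← Real.exp_nat_mul, ← Real.exp_add]
    refine Real.exp_le_exp.2 ?_
    push_cast
    nlinarith [mul_nonneg hc (sub_nonneg.2 ht2), mul_nonneg hc (sq_nonneg R)]
  have h1 := norm_pow_sub_pow_le_mul hx hw (n - 1)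
  have h2 : ‖w ^ n - G‖ ≤ g * (n * |α| * |t| ^ 3) ^ 2 :=
    (norm_cumulantExp_pow_sub_edgeworthCharFun_le b α n t).trans (by gcongr)
  have h2' : ‖w ^ n - (e₀ : ℂ)‖ ≤ g * (n * |α| * |t| ^ 3) :=
    (norm_cumulantExp_pow_sub_le b α n t).trans (by gcongr)
  have h3 : ‖G‖ ≤ g * (1 + n * |α| * |t| ^ 3) :=
    (norm_edgeworthCharFun_le b α n t).trans (by gcongr)
  have h3' : ‖edgeworthCharFunDeriv b α n t‖
      ≤ g * (n * b * |t| * (1 + n * |α| * |t| ^ 3) + 3 * n * |α| * |t| ^ 2) := by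
    rw [edgeworthCharFunDeriv, ← hG, ← he₀]
    calc _ ≤ n * b * |t| * (g * (1 + n * |α| * |t| ^ 3)) + g * (3 * n * |α| * |t| ^ 2) := by
          refine (norm_sub_le _ _).trans (add_le_add ?_ ?_)
          · rw [norm_mul]
            have : ‖(-(n * b * t) : ℂ)‖ = n * b * |t| := by simp [abs_of_nonneg hb]
            rw [this]
            gcongr
          · rw [norm_mul, norm_real, Real.norm_of_nonneg he0]
            have : ‖(3 * I * n * α * t ^ 2 : ℂ)‖ = 3 * n * |α| * |t| ^ 2 := by simp
            rw [this]
            gcongr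
      _ = _ := by ring
  have hnw : n * w ^ (n - 1) * w = n * w ^ n := by
    rcases n with _ | m
    · simp
    · rw [Nat.add_sub_cancel]; ring
  -- Besides the errors in `x`, `x'` and `k`, the derivative of `w ^ n` is compared term by term
  -- with that of the Edgeworth transform. The term with `n b t` carries `G` and needs the second
  -- order bound `h2`; the one with `3 n α t²` carries only the Gaussian factor, where the first
  -- order bound `h2'` is enough.
  have e : n * x ^ (n - 1) * x'
        - (k' * G + k * edgeworthCharFunDeriv b α n t)
      = n * (x ^ (n - 1) - w ^ (n - 1)) * x'
        + n * w ^ (n - 1) * (x' - (-b * t - 3 * I * α * t ^ 2) * w)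
        + -(n * b * t) * (w ^ n - G)
        + -(3 * n * I * α * t ^ 2) * (w ^ n - (e₀ : ℂ))
        + (1 - k) * edgeworthCharFunDeriv b α n t
        + -k' * G := by
    have : edgeworthCharFunDeriv b α n t = -(n * b * t) * G - (e₀ : ℂ) * (3 * I * n * α * t ^ 2) :=
      rfl
    linear_combination (-b * t - 3 * I * α * t ^ 2) * hnw - this
  rw [e]
  calc _ ≤ n * (A * g) * (n * (M * |t| ^ 4)) * (M * |t|) + n * (A * g) * (M * |t| ^ 3)
        + n * b * |t| * (g * (n * |α| * |t| ^ 3) ^ 2)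
        + 3 * n * |α| * |t| ^ 2 * (g * (n * |α| * |t| ^ 3))
        + M * |t| ^ 2 * (g * (n * b * |t| * (1 + n * |α| * |t| ^ 3) + 3 * n * |α| * |t| ^ 2))
        + M * |t| * (g * (1 + n * |α| * |t| ^ 3)) := by
        refine (norm_add_le _ _).trans (add_le_add ((norm_add_le _ _).trans (add_le_add
          ((norm_add_le _ _).trans (add_le_add (norm_add₃_le.trans
          (add_le_add (add_le_add ?_ ?_) ?_)) ?_)) ?_)) ?_)
        · rw [norm_mul, norm_mul, Complex.norm_natCast]
          refine mul_le_mul ?_ hx' (norm_nonneg _) (by positivity)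
          calc n * ‖x ^ (n - 1) - w ^ (n - 1)‖ ≤ n * (n * (A * g) * (M * |t| ^ 4)) := by
                refine mul_le_mul_of_nonneg_left (h1.trans ?_) (by positivity)
                gcongr
            _ = _ := by ring
        · rw [norm_mul, norm_mul, Complex.norm_natCast, norm_pow]
          refine mul_le_mul (le_trans ?_ hpow) hxw' (norm_nonneg _) (by positivity)
          gcongr
        · rw [norm_mul]
          have : ‖(-(n * b * t) : ℂ)‖ = n * b * |t| := by simp [abs_of_nonneg hb]
          rw [this]
          gcongr
        · rw [norm_mul]
          have : ‖(-(3 * n * I * α * t ^ 2) : ℂ)‖ = 3 * n * |α| * |t| ^ 2 := by simp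
          rw [this]
          gcongr
        · rw [norm_mul, norm_sub_rev]
          gcongr
        · rw [norm_mul, norm_neg]
          gcongr
    _ = _ := by ring

end EdgeworthCharFun

/-! ### Uniform bounds in the scaled variable `√n |t|` -/

section EdgeworthBounds

open Complex

/-- Half of the Gaussian exponent absorbs the polynomial, through `y ^ p / p! ≤ exp y`. -/
lemma exists_one_add_pow_mul_exp_le {c : ℝ} (hc : 0 < c) (p : ℕ) :
    ∃ B, 0 ≤ B ∧ ∀ s : ℝ, 0 ≤ s →
      (1 + s ^ (2 * p)) * Real.exp (-c * s ^ 2) ≤ B * Real.exp (-(c / 2) * s ^ 2) := by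
  refine ⟨1 + p.factorial * (2 / c) ^ p, by positivity, fun s _ => ?_⟩
  have e : Real.exp (-c * s ^ 2) = Real.exp (-(c / 2 * s ^ 2)) * Real.exp (-(c / 2) * s ^ 2) := by
    rw [← Real.exp_add]; ring_nf
  rw [e, ← mul_assoc]
  refine mul_le_mul_of_nonneg_right ?_ (Real.exp_pos _).le
  rw [Real.exp_neg, ← div_eq_mul_inv, div_le_iff₀ (Real.exp_pos _)]
  have hy : 0 ≤ c / 2 * s ^ 2 := by positivity
  have h1 := Real.pow_div_factorial_le_exp _ hy p
  have h2 := Real.one_le_exp hy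
  have h3 : s ^ (2 * p) = p.factorial * (2 / c) ^ p * ((c / 2 * s ^ 2) ^ p / p.factorial) := by
    rw [mul_pow (c / 2), ← pow_mul]
    have : (2 / c) ^ p * (c / 2) ^ p = 1 := by rw [← mul_pow]; field_simp; simp
    field_simp
    linear_combination (-s ^ (2 * p)) * this
  rw [h3, add_mul, one_mul]
  gcongr

lemma pow_le_one_add_pow {s : ℝ} (hs : 0 ≤ s) {p q : ℕ} (h : p ≤ q) : s ^ p ≤ 1 + s ^ q := by
  rcases le_total s 1 with h1 | h1
  · have := pow_le_one₀ (n := p) hs h1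
    have := pow_nonneg hs q
    linarith
  · have := pow_le_pow_right₀ h1 h
    linarith

lemma exists_edgeworth_bounds {φ φ' k k' : ℝ → ℂ} {b α c M R : ℝ} (hc : 0 < c)
    (hcb : c ≤ b / 2) (hM : 0 ≤ M)
    (hφ : ∀ t, |t| ≤ R → ‖φ t‖ ≤ Real.exp (-c * t ^ 2))
    (hφw : ∀ t, |t| ≤ R → ‖φ t - cumulantExp b α t‖ ≤ M * |t| ^ 4)
    (hφ' : ∀ t, |t| ≤ R → ‖φ' t‖ ≤ M * |t|)
    (hφw' : ∀ t, |t| ≤ R →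
      ‖φ' t - (-b * t - 3 * I * α * t ^ 2) * cumulantExp b α t‖ ≤ M * |t| ^ 3)
    (hk : ∀ t, |t| ≤ R → ‖k t - 1‖ ≤ M * |t| ^ 2) (hk' : ∀ t, |t| ≤ R → ‖k' t‖ ≤ M * |t|) :
    ∃ C c', 0 ≤ C ∧ 0 < c' ∧ ∀ n : ℕ, 1 ≤ n → ∀ t, |t| ≤ R →
      ‖φ t ^ n - k t * edgeworthCharFun b α n t‖ ≤ C / n * Real.exp (-c' * (n * t ^ 2)) ∧
      ‖n * φ t ^ (n - 1) * φ' t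
        - (k' t * edgeworthCharFun b α n t + k t * edgeworthCharFunDeriv b α n t)‖
        ≤ C / √n * Real.exp (-c' * (n * t ^ 2)) := by
  have hb : 0 ≤ b := by linarith
  obtain ⟨B, hB0, hB⟩ := exists_one_add_pow_mul_exp_le hc 4
  set A := Real.exp (2 * c * R ^ 2) with hA
  set C₁ := A * M + |α| ^ 2 + M + M * |α| with hC₁
  set C₂ := A * M ^ 2 + A * M + b * |α| ^ 2 + 3 * |α| ^ 2 + M * (b + b * |α| + 3 * |α|)
    + M * (1 + |α|) with hC₂
  have hC₁0 : 0 ≤ C₁ := by positivity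
  have hC₂0 : 0 ≤ C₂ := by positivity
  refine ⟨(C₁ + C₂) * B, c / 2, by positivity, by positivity, fun n hn t ht => ?_⟩
  set r := √(n : ℝ) with hr
  have hn1 : (1 : ℝ) ≤ n := by exact_mod_cast hn
  have hr1 : 1 ≤ r := by rw [hr]; exact Real.one_le_sqrt.2 hn1
  have hrn : (n : ℝ) = r ^ 2 := by rw [hr, Real.sq_sqrt (by linarith)]
  set T := |t| with hT
  have hT0 : 0 ≤ T := abs_nonneg t
  set s := r * T with hs
  have hs0 : 0 ≤ s := by positivity
  have hs2 : (n : ℝ) * t ^ 2 = s ^ 2 := by rw [hrn, hs, hT, mul_pow, sq_abs]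
  have hP (p : ℕ) (hp : p ≤ 8) : s ^ p ≤ 1 + s ^ (2 * 4) := pow_le_one_add_pow hs0 hp
  have hBs := hB s hs0
  have hg0 := (Real.exp_pos (-c * s ^ 2)).le
  have hrpow (p q : ℕ) (hpq : p ≤ q) : r ^ p ≤ r ^ q := pow_le_pow_right₀ hr1 hpq
  have key : ∀ {X P C : ℝ}, 0 ≤ C → X ≤ Real.exp (-c * s ^ 2) * P → P ≤ C * (1 + s ^ (2 * 4)) →
      C ≤ C₁ + C₂ → X ≤ (C₁ + C₂) * B * Real.exp (-(c / 2) * s ^ 2) := by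
    intro X P C hC h1 h2 h3
    calc X ≤ Real.exp (-c * s ^ 2) * ((C₁ + C₂) * (1 + s ^ (2 * 4))) := by
          refine h1.trans (mul_le_mul_of_nonneg_left (h2.trans ?_) hg0)
          gcongr
      _ = (C₁ + C₂) * ((1 + s ^ (2 * 4)) * Real.exp (-c * s ^ 2)) := by ring
      _ ≤ (C₁ + C₂) * (B * Real.exp (-(c / 2) * s ^ 2)) := by gcongr
      _ = _ := by ring
  constructor
  · have h := norm_pow_sub_mul_edgeworthCharFun_le hc.le hcb hM ht (hφ t ht) (hφw t ht) (hk t ht)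
      (n := n)
    rw [hs2, ← hT, ← hA] at h
    rw [hs2, div_mul_eq_mul_div, le_div_iff₀ (by linarith)]
    refine key hC₁0 (P := A * M * s ^ 4 + |α| ^ 2 * s ^ 6 + M * s ^ 2 + M * |α| * s ^ 5) ?_ ?_
      (by linarith)
    · refine (mul_le_mul_of_nonneg_right h (by linarith)).trans ?_
      rw [mul_assoc]
      refine mul_le_mul_of_nonneg_left ?_ hg0
      rw [hrn, hs]
      -- This term is smaller than required by a factor `√n`, which is given away.
      have h5 : M * |α| * T ^ 5 * r ^ 4 ≤ M * |α| * T ^ 5 * r ^ 5 := by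
        have := hrpow 4 5 (by norm_num)
        gcongr
      linarith
    · rw [hC₁]
      have := mul_le_mul_of_nonneg_left (hP 4 (by norm_num)) (by positivity : 0 ≤ A * M)
      have := mul_le_mul_of_nonneg_left (hP 6 (by norm_num)) (by positivity : 0 ≤ |α| ^ 2)
      have := mul_le_mul_of_nonneg_left (hP 2 (by norm_num)) hM
      have := mul_le_mul_of_nonneg_left (hP 5 (by norm_num)) (by positivity : 0 ≤ M * |α|)
      linarith
  · have h := norm_deriv_pow_sub_mul_edgeworthCharFun_le hc.le hcb hM ht (hφ t ht) (hφw t ht)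
      (hφ' t ht) (hφw' t ht) (hk t ht) (hk' t ht) (n := n)
    rw [hs2, ← hT, ← hA] at h
    rw [hs2, div_mul_eq_mul_div, le_div_iff₀ (by linarith)]
    refine key hC₂0 (P := A * M ^ 2 * s ^ 5 + A * M * s ^ 3 + b * |α| ^ 2 * s ^ 7
      + 3 * |α| ^ 2 * s ^ 5 + M * (b * s ^ 3 + b * |α| * s ^ 6 + 3 * |α| * s ^ 4)
      + M * (s + |α| * s ^ 4)) ?_ ?_ (by linarith)
    · refine (mul_le_mul_of_nonneg_right h (by linarith)).trans ?_
      rw [mul_assoc]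
      refine mul_le_mul_of_nonneg_left ?_ hg0
      rw [hrn, hs]
      have h5 : M * b * |α| * T ^ 6 * r ^ 5 ≤ M * b * |α| * T ^ 6 * r ^ 6 := by
        have := hrpow 5 6 (by norm_num)
        gcongr
      have h6 : M * |α| * T ^ 4 * r ^ 3 ≤ M * |α| * T ^ 4 * r ^ 4 := by
        have := hrpow 3 4 (by norm_num)
        gcongr
      linarith
    · rw [hC₂]
      have := mul_le_mul_of_nonneg_left (hP 5 (by norm_num)) (by positivity : 0 ≤ A * M ^ 2)
      have := mul_le_mul_of_nonneg_left (hP 3 (by norm_num)) (by positivity : 0 ≤ A * M)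
      have := mul_le_mul_of_nonneg_left (hP 7 (by norm_num)) (by positivity : 0 ≤ b * |α| ^ 2)
      have := mul_le_mul_of_nonneg_left (hP 5 (by norm_num)) (by positivity : 0 ≤ 3 * |α| ^ 2)
      have := mul_le_mul_of_nonneg_left (hP 3 (by norm_num)) (by positivity : 0 ≤ M * b)
      have := mul_le_mul_of_nonneg_left (hP 6 (by norm_num)) (by positivity : 0 ≤ M * (b * |α|))
      have := mul_le_mul_of_nonneg_left (hP 4 (by norm_num)) (by positivity : 0 ≤ M * (3 * |α|))
      have := mul_le_mul_of_nonneg_left (hP 1 (by norm_num)) hM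
      have := mul_le_mul_of_nonneg_left (hP 4 (by norm_num)) (by positivity : 0 ≤ M * |α|)
      linarith

end EdgeworthBounds

/-! ### Summing Fourier coefficients by weighted Cauchy-Schwarz -/

section FourierSummation

open Complex

/-- The oscillatory factor `exp (-i y t)`. -/
noncomputable def oscExp (y t : ℝ) : ℂ := cexp ((-(y * t) : ℝ) * I)

@[simp] lemma norm_oscExp (y t : ℝ) : ‖oscExp y t‖ = 1 := norm_exp_ofReal_mul_I _

lemma continuous_oscExp (y : ℝ) : Continuous (oscExp y) := by
  unfold oscExp; fun_prop

lemma hasDerivAt_oscExp (y t : ℝ) : HasDerivAt (oscExp y) (-(I * y) * oscExp y t) t := by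
  have h := (((hasDerivAt_id t).const_mul y).neg.ofReal_comp.mul_const I).cexp
  refine h.congr_deriv ?_
  simp [oscExp]
  ring

/-- Comparison with the integral of `1 / (n + (x - θ)²)`, which is `π / √n`. Moving `x` by at most
`1 / 2` changes the denominator by a factor at most `2`, because `n ≥ 1`. -/
lemma sum_inv_add_sq_le (θ : ℝ) {n : ℕ} (hn : 1 ≤ n) (s : Finset ℤ) :
    ∑ k ∈ s, ((n : ℝ) + (k - θ) ^ 2)⁻¹ ≤ 2 * Real.pi / √n := by
  have hn1 : (1 : ℝ) ≤ n := by exact_mod_cast hn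
  have hn0 : (0 : ℝ) < n := by linarith
  have hr : 0 < √(n : ℝ) := Real.sqrt_pos.2 hn0
  set F : ℝ → ℝ := fun x => ((n : ℝ) + (x - θ) ^ 2)⁻¹ with hF
  have hFe : F = fun x => (n : ℝ)⁻¹ * (fun y : ℝ => (1 + (y / √n) ^ 2)⁻¹) (x - θ) := by
    funext x
    simp only [hF]
    rw [div_pow, Real.sq_sqrt hn0.le, ← mul_inv]
    congr 1
    field_simp
  have hint0 : Integrable fun y : ℝ => (1 + (y / √n) ^ 2)⁻¹ :=
    integrable_inv_one_add_sq.comp_div hr.ne'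
  have hFint : Integrable F := by
    rw [hFe]
    exact (hint0.comp_sub_right θ).const_mul _
  have hFtot : ∫ x, F x = Real.pi / √n := by
    rw [hFe, integral_const_mul, integral_sub_right_eq_self (fun y : ℝ => (1 + (y / √n) ^ 2)⁻¹) θ,
      Measure.integral_comp_div (fun y : ℝ => (1 + y ^ 2)⁻¹), integral_univ_inv_one_add_sq,
      abs_of_pos hr, smul_eq_mul]
    nth_rewrite 1 [← Real.sq_sqrt hn0.le]
    field_simp
  have hF0 : ∀ x, 0 ≤ F x := fun x => by simp only [hF]; positivity
  set S : ℤ → Set ℝ := fun k => Set.Ioc (k - 1 / 2 : ℝ) (k + 1 / 2) with hS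
  have hterm : ∀ k ∈ s, ((n : ℝ) + (k - θ) ^ 2)⁻¹ ≤ 2 * ∫ x in S k, F x := by
    intro k _
    have h1 : ∫ _ in S k, (2 * ((n : ℝ) + (k - θ) ^ 2))⁻¹ ≤ ∫ x in S k, F x := by
      refine setIntegral_mono_on (integrableOn_const (by simp [hS])) hFint.integrableOn
        measurableSet_Ioc fun x hx => ?_
      refine inv_anti₀ (by positivity) ?_
      have hx1 : |x - k| ≤ 1 / 2 := abs_le.2 ⟨by linarith [hx.1], by linarith [hx.2]⟩
      have hx2 : (x - k) ^ 2 ≤ 1 / 4 := by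
        rw [← sq_abs]; nlinarith [abs_nonneg (x - k)]
      nlinarith [sq_nonneg ((k - θ) - (x - k))]
    rw [setIntegral_const, Real.volume_real_Ioc_of_le (by linarith)] at h1
    rw [mul_inv, smul_eq_mul] at h1
    linarith
  have hdisj : Pairwise (Function.onFun Disjoint S) := by
    intro i j hij
    refine Set.disjoint_left.2 fun x hi hj => hij ?_
    have h1 : (i : ℝ) < j + 1 := by linarith [hi.1, hj.2]
    have h2 : (j : ℝ) < i + 1 := by linarith [hj.1, hi.2]
    have h1' : i < j + 1 := by exact_mod_cast h1
    have h2' : j < i + 1 := by exact_mod_cast h2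
    omega
  calc _ ≤ ∑ k ∈ s, 2 * ∫ x in S k, F x := Finset.sum_le_sum hterm
    _ = 2 * ∫ x in ⋃ k ∈ s, S k, F x := by
        rw [← Finset.mul_sum, integral_biUnion_finset s (fun _ _ => measurableSet_Ioc)
          (fun i _ j _ h => hdisj h) fun _ _ => hFint.integrableOn]
    _ ≤ 2 * ∫ x, F x := by
        gcongr
        · exact ae_of_all _ hF0
        · exact Measure.restrict_le_self
    _ = _ := by rw [hFtot]; ring

/-- Bessel's inequality: the real shift `θ` is absorbed into the function as a unimodular factor. -/
lemma sum_sq_norm_integral_oscExp_le {f : ℝ → ℂ} (hf : Continuous f) (θ : ℝ) (s : Finset ℤ) :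
    ∑ k ∈ s, ‖∫ t in -Real.pi..Real.pi, oscExp (k - θ) t * f t‖ ^ 2
      ≤ 2 * Real.pi * ∫ t in -Real.pi..Real.pi, ‖f t‖ ^ 2 := by
  have hpi := Real.pi_pos
  have hab : -Real.pi < Real.pi := by linarith
  set F : ℝ → ℂ := fun t => oscExp (-θ) t * f t with hF
  have hFc : Continuous F := (continuous_oscExp _).mul hf
  have hL2 : MemLp F 2 (volume.restrict (Set.Ioc (-Real.pi) Real.pi)) := by
    refine (memLp_two_iff_integrable_sq_norm hFc.aestronglyMeasurable).2 ?_
    exact ((hFc.norm.pow 2).integrableOn_Icc).mono_set Set.Ioc_subset_Icc_self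
  have hsum := hasSum_sq_fourierCoeffOn hab hL2
  have h1 := sum_le_hasSum s (fun k _ => by positivity) hsum
  have hcoef : ∀ k : ℤ, fourierCoeffOn hab F k
      = (1 / (2 * Real.pi) : ℝ) • ∫ t in -Real.pi..Real.pi, oscExp (k - θ) t * f t := by
    intro k
    rw [fourierCoeffOn_eq_integral, sub_neg_eq_add, ← two_mul]
    congr 1
    refine intervalIntegral.integral_congr fun t _ => ?_
    simp only [hF]
    rw [smul_eq_mul, fourier_coe_apply, ← mul_assoc]
    congr 1
    rw [oscExp, oscExp, ← Complex.exp_add]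
    congr 1
    have : (Real.pi : ℂ) ≠ 0 := by exact_mod_cast hpi.ne'
    push_cast
    field_simp
    ring
  simp_rw [hcoef, norm_smul, mul_pow] at h1
  rw [← Finset.mul_sum, Real.norm_of_nonneg (by positivity), sub_neg_eq_add, ← two_mul,
    smul_eq_mul] at h1
  have h2 : ∀ t, ‖F t‖ = ‖f t‖ := fun t => by simp [hF]
  simp_rw [h2] at h1
  have h3 := mul_le_mul_of_nonneg_left h1 (by positivity : 0 ≤ (2 * Real.pi) ^ 2)
  calc _ = (2 * Real.pi) ^ 2 * ((1 / (2 * Real.pi)) ^ 2 *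
        ∑ k ∈ s, ‖∫ t in -Real.pi..Real.pi, oscExp (k - θ) t * f t‖ ^ 2) := by
        rw [← mul_assoc, ← mul_pow]; field_simp
    _ ≤ _ := h3
    _ = _ := by field_simp

lemma integral_sq_norm_le_of_gaussian_bound {f : ℝ → ℂ} (hf : Continuous f) {A c : ℝ} (hc : 0 < c)
    {n : ℕ} (hn : 1 ≤ n)
    (h : ∀ t, |t| ≤ Real.pi → ‖f t‖ ≤ A * Real.exp (-c * (n * t ^ 2))) :
    ∫ t in -Real.pi..Real.pi, ‖f t‖ ^ 2 ≤ A ^ 2 * √(Real.pi / (2 * c)) / √n := by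
  have hpi := Real.pi_pos
  have hn0 : (0 : ℝ) < n := by exact_mod_cast hn
  have hcn : 0 < 2 * c * n := by positivity
  have hg : Integrable fun t : ℝ => A ^ 2 * Real.exp (-(2 * c * n) * t ^ 2) :=
    (integrable_exp_neg_mul_sq hcn).const_mul _
  rw [intervalIntegral.integral_of_le (by linarith)]
  calc _ ≤ ∫ t in Set.Ioc (-Real.pi) Real.pi, A ^ 2 * Real.exp (-(2 * c * n) * t ^ 2) := by
        refine setIntegral_mono_on ((hf.norm.pow 2).integrableOn_Icc.mono_set
          Set.Ioc_subset_Icc_self) hg.integrableOn measurableSet_Ioc fun t ht => ?_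
        have h1 := h t (abs_le.2 ⟨ht.1.le, ht.2⟩)
        calc ‖f t‖ ^ 2 ≤ (A * Real.exp (-c * (n * t ^ 2))) ^ 2 := by gcongr
          _ = _ := by rw [mul_pow, ← Real.exp_nat_mul]; congr 2; push_cast; ring
    _ ≤ ∫ t, A ^ 2 * Real.exp (-(2 * c * n) * t ^ 2) :=
        setIntegral_le_integral hg (ae_of_all _ fun t => by positivity)
    _ = _ := by
        rw [integral_const_mul, integral_gaussian, ← div_div, Real.sqrt_div' _ hn0.le, mul_div_assoc]

/-- Integration by parts. The function need not match at `±π`, so boundary terms appear and are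
bounded by `2 ε`. -/
lemma norm_mul_integral_oscExp_le {f f' : ℝ → ℂ} (hf : ∀ t, HasDerivAt f (f' t) t)
    (hf' : Continuous f') {ε : ℝ} (h1 : ‖f Real.pi‖ ≤ ε) (h2 : ‖f (-Real.pi)‖ ≤ ε) (y : ℝ) :
    |y| * ‖∫ t in -Real.pi..Real.pi, oscExp y t * f t‖
      ≤ ‖∫ t in -Real.pi..Real.pi, oscExp y t * f' t‖ + 2 * ε := by
  have hfc : Continuous f := continuous_iff_continuousAt.2 fun t => (hf t).continuousAt
  have hc1 : Continuous fun t => -(I * y) * oscExp y t * f t :=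
    (continuous_const.mul (continuous_oscExp y)).mul hfc
  have hc2 : Continuous fun t => oscExp y t * f' t := (continuous_oscExp y).mul hf'
  have hparts := intervalIntegral.integral_eq_sub_of_hasDerivAt (a := -Real.pi) (b := Real.pi)
    (fun t _ => (hasDerivAt_oscExp y t).mul (hf t)) ((hc1.add hc2).intervalIntegrable _ _)
  rw [intervalIntegral.integral_add (hc1.intervalIntegrable _ _)
    (hc2.intervalIntegrable _ _)] at hparts
  have e : (I * y) * ∫ t in -Real.pi..Real.pi, oscExp y t * f t
      = (∫ t in -Real.pi..Real.pi, oscExp y t * f' t)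
        - (oscExp y Real.pi * f Real.pi - oscExp y (-Real.pi) * f (-Real.pi)) := by
    have : ∫ t in -Real.pi..Real.pi, -(I * y) * oscExp y t * f t
        = -(I * y) * ∫ t in -Real.pi..Real.pi, oscExp y t * f t := by
      rw [← intervalIntegral.integral_const_mul]
      simp_rw [mul_assoc]
    rw [this] at hparts
    simp only [Pi.mul_apply] at hparts
    linear_combination -hparts
  have e2 : |y| * ‖∫ t in -Real.pi..Real.pi, oscExp y t * f t‖
      = ‖(I * y) * ∫ t in -Real.pi..Real.pi, oscExp y t * f t‖ := by simp
  rw [e2, e]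
  refine (norm_sub_le _ _).trans (add_le_add le_rfl ((norm_sub_le _ _).trans ?_))
  rw [norm_mul, norm_mul, norm_oscExp, norm_oscExp]
  linarith

/-- The weight `n + (k - θ)²` balances the two Gaussian bounds: `n ∑ |a k|²` and `∑ (k - θ)² |a k|²`
are both of order `n^(-3/2)`. The cardinality of `s` enters only through the boundary terms of the
integration by parts. -/
lemma exists_sum_norm_integral_oscExp_le {A c : ℝ} (hA : 0 ≤ A) (hc : 0 < c) :
    ∃ C, 0 ≤ C ∧ ∀ n : ℕ, 1 ≤ n → ∀ (f f' : ℝ → ℂ), (∀ t, HasDerivAt f (f' t) t) → Continuous f' →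
      (∀ t, |t| ≤ Real.pi → ‖f t‖ ≤ A / n * Real.exp (-c * (n * t ^ 2))) →
      (∀ t, |t| ≤ Real.pi → ‖f' t‖ ≤ A / √n * Real.exp (-c * (n * t ^ 2))) →
      ∀ (θ : ℝ) (s : Finset ℤ), (s.card : ℝ) ≤ 5 * n →
        ∑ k ∈ s, ‖∫ t in -Real.pi..Real.pi, oscExp (k - θ) t * f t‖ ≤ C / n := by
  have hpi := Real.pi_pos
  set B := 2 * Real.pi * A ^ 2 * √(Real.pi / (2 * c)) with hB
  have hB0 : 0 ≤ B := by positivity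
  set ε₀ := A / (c * Real.pi ^ 2) with hε₀
  have hε₀0 : 0 ≤ ε₀ := by positivity
  set V := 3 * B + 40 * ε₀ ^ 2 with hV
  refine ⟨√(2 * Real.pi * V), by positivity, fun n hn f f' hf hf' hbd hbd' θ s hs => ?_⟩
  have hfc : Continuous f := continuous_iff_continuousAt.2 fun t => (hf t).continuousAt
  have hn1 : (1 : ℝ) ≤ n := by exact_mod_cast hn
  have hn0 : (0 : ℝ) < n := by linarith
  set r := √(n : ℝ) with hr
  have hr1 : 1 ≤ r := Real.one_le_sqrt.2 hn1
  have hr0 : 0 < r := by linarith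
  have hrn : (n : ℝ) = r ^ 2 := by rw [hr, Real.sq_sqrt hn0.le]
  set a : ℤ → ℝ := fun k => ‖∫ t in -Real.pi..Real.pi, oscExp (k - θ) t * f t‖ with ha
  set d : ℤ → ℝ := fun k => ‖∫ t in -Real.pi..Real.pi, oscExp (k - θ) t * f' t‖ with hd
  have ha0 : ∀ k, 0 ≤ a k := fun k => norm_nonneg _
  have hd0 : ∀ k, 0 ≤ d k := fun k => norm_nonneg _
  -- Boundary values at `±π` are in fact exponentially small; `exp (-y) ≤ 1 / y` already suffices.
  have hε : A / n * Real.exp (-c * (n * Real.pi ^ 2)) ≤ ε₀ / n ^ 2 := by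
    have h1 : Real.exp (-c * (n * Real.pi ^ 2)) ≤ (c * Real.pi ^ 2 * n)⁻¹ := by
      rw [show -c * (n * Real.pi ^ 2) = -(c * Real.pi ^ 2 * n) by ring, Real.exp_neg]
      refine inv_anti₀ (by positivity) ?_
      linarith [Real.add_one_le_exp (c * Real.pi ^ 2 * n)]
    calc _ ≤ A / n * (c * Real.pi ^ 2 * n)⁻¹ := by gcongr
      _ = _ := by rw [hε₀]; field_simp
  have hsa : ∑ k ∈ s, a k ^ 2 ≤ B / (n ^ 2 * r) := by
    refine (sum_sq_norm_integral_oscExp_le hfc θ s).trans ?_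
    calc _ ≤ 2 * Real.pi * ((A / n) ^ 2 * √(Real.pi / (2 * c)) / √n) := by
          gcongr; exact integral_sq_norm_le_of_gaussian_bound hfc hc hn hbd
      _ = _ := by rw [hB, ← hr]; field_simp
  have hsd : ∑ k ∈ s, d k ^ 2 ≤ B / (n * r) := by
    refine (sum_sq_norm_integral_oscExp_le hf' θ s).trans ?_
    calc _ ≤ 2 * Real.pi * ((A / √n) ^ 2 * √(Real.pi / (2 * c)) / √n) := by
          gcongr; exact integral_sq_norm_le_of_gaussian_bound hf' hc hn hbd'
      _ = _ := by rw [hB, div_pow, Real.sq_sqrt hn0.le, ← hr]; field_simp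
  have hya : ∀ k : ℤ, (k - θ) ^ 2 * a k ^ 2 ≤ 2 * d k ^ 2 + 8 * (ε₀ / n ^ 2) ^ 2 := by
    intro k
    have h := norm_mul_integral_oscExp_le hf hf' (ε := ε₀ / n ^ 2)
      ((hbd _ (abs_of_pos hpi).le).trans hε)
      ((hbd _ (by rw [abs_neg, abs_of_pos hpi])).trans (by rwa [neg_sq])) (k - θ)
    change |(k : ℝ) - θ| * a k ≤ d k + 2 * (ε₀ / n ^ 2) at h
    have h0 : 0 ≤ |(k : ℝ) - θ| * a k := mul_nonneg (abs_nonneg _) (ha0 k)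
    calc (k - θ) ^ 2 * a k ^ 2 = (|(k : ℝ) - θ| * a k) ^ 2 := by rw [mul_pow, sq_abs]
      _ ≤ (d k + 2 * (ε₀ / n ^ 2)) ^ 2 := by gcongr
      _ ≤ _ := by nlinarith [sq_nonneg (d k - 2 * (ε₀ / n ^ 2))]
  have hweight : ∑ k ∈ s, (n + (k - θ) ^ 2) * a k ^ 2 ≤ V / (n * r) := by
    calc _ = n * ∑ k ∈ s, a k ^ 2 + ∑ k ∈ s, (k - θ) ^ 2 * a k ^ 2 := by
          rw [Finset.mul_sum, ← Finset.sum_add_distrib]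
          exact Finset.sum_congr rfl fun k _ => by ring
      _ ≤ n * (B / (n ^ 2 * r)) + (2 * (B / (n * r)) + 5 * n * (8 * (ε₀ / n ^ 2) ^ 2)) := by
          gcongr
          calc _ ≤ ∑ k ∈ s, (2 * d k ^ 2 + 8 * (ε₀ / n ^ 2) ^ 2) :=
                Finset.sum_le_sum fun k _ => hya k
            _ = 2 * ∑ k ∈ s, d k ^ 2 + s.card * (8 * (ε₀ / n ^ 2) ^ 2) := by
                rw [Finset.sum_add_distrib, Finset.mul_sum, Finset.sum_const, nsmul_eq_mul]
            _ ≤ _ := by gcongr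
      _ = 3 * B / (n * r) + 40 * ε₀ ^ 2 / (n * n ^ 2) := by field_simp; ring
      _ ≤ 3 * B / (n * r) + 40 * ε₀ ^ 2 / (n * r) := by
          gcongr
          rw [hrn]
          nlinarith [pow_le_pow_right₀ hr1 (show 1 ≤ 4 by norm_num)]
      _ = _ := by rw [hV]; ring
  have hCS := Finset.sum_mul_sq_le_sq_mul_sq s (fun k : ℤ => √((n : ℝ) + (k - θ) ^ 2)⁻¹)
    (fun k => √((n : ℝ) + (k - θ) ^ 2) * a k)
  have e1 : ∀ k : ℤ, √((n : ℝ) + (k - θ) ^ 2)⁻¹ * (√((n : ℝ) + (k - θ) ^ 2) * a k) = a k := by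
    intro k
    have : 0 < √((n : ℝ) + (k - θ) ^ 2) := Real.sqrt_pos.2 (by positivity)
    rw [Real.sqrt_inv]
    field_simp
  have e2 : ∀ k : ℤ, √((n : ℝ) + (k - θ) ^ 2)⁻¹ ^ 2 = ((n : ℝ) + (k - θ) ^ 2)⁻¹ := fun k =>
    Real.sq_sqrt (by positivity)
  have e3 : ∀ k : ℤ, (√((n : ℝ) + (k - θ) ^ 2) * a k) ^ 2 = (n + (k - θ) ^ 2) * a k ^ 2 := by
    intro k
    rw [mul_pow, Real.sq_sqrt (by positivity)]
  simp_rw [e1, e2, e3] at hCS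
  rw [← Real.sqrt_sq hn0.le, ← Real.sqrt_div' _ (by positivity)]
  refine Real.le_sqrt_of_sq_le (hCS.trans ?_)
  calc _ ≤ (2 * Real.pi / r) * (V / (n * r)) := by
        refine mul_le_mul (sum_inv_add_sq_le θ hn s) hweight
          (Finset.sum_nonneg fun k _ => by positivity) (by positivity)
    _ = _ := by rw [hrn]; field_simp

end FourierSummation

/-! ### Fourier representation of the Edgeworth mass of a cell -/

section GaussianInversion

open Complex

/-- The uniform probability measure on `(-1/2, 1/2]`. -/
noncomputable def unitCell : Measure ℝ := volume.restrict (Set.Ioc (-(1 / 2)) (1 / 2))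

instance : IsProbabilityMeasure unitCell := ⟨by simp [unitCell]; norm_num⟩

lemma integrable_unitCell {f : ℝ → ℝ} (hf : Continuous f) : Integrable f unitCell :=
  hf.integrableOn_Icc.mono_set Set.Ioc_subset_Icc_self

lemma integral_id_unitCell : ∫ x, x ∂unitCell = 0 := by
  rw [unitCell, ← intervalIntegral.integral_of_le (by norm_num), integral_id]
  norm_num

lemma iteratedDeriv_three_exp_neg_sq_div_two (t : ℝ) :
    iteratedDeriv 3 (fun t : ℝ => cexp (-(t ^ 2 / 2))) t
      = (3 * t - t ^ 3) * cexp (-(t ^ 2 / 2)) := by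
  have h0 : ∀ t : ℝ, HasDerivAt (fun t : ℝ => cexp (-(t ^ 2 / 2)))
      (-t * cexp (-(t ^ 2 / 2))) t := fun t =>
    ((((hasDerivAt_id t).ofReal_comp.pow 2).div_const 2).neg.cexp).congr_deriv (by simp; ring)
  have hid : ∀ t : ℝ, HasDerivAt (fun t : ℝ => (t : ℂ)) 1 t := fun t =>
    (hasDerivAt_id t).ofReal_comp
  have h1 : ∀ t : ℝ, HasDerivAt (fun t : ℝ => -t * cexp (-(t ^ 2 / 2)))
      ((t ^ 2 - 1) * cexp (-(t ^ 2 / 2))) t := fun t =>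
    ((hid t).neg.mul (h0 t)).congr_deriv (by simp only [Pi.neg_apply]; ring)
  have h2 : ∀ t : ℝ, HasDerivAt (fun t : ℝ => ((t : ℂ) ^ 2 - 1) * cexp (-(t ^ 2 / 2)))
      ((3 * t - t ^ 3) * cexp (-(t ^ 2 / 2))) t := fun t =>
    ((((hid t).pow 2).sub_const 1).mul (h0 t)).congr_deriv (by simp; ring)
  rw [iteratedDeriv_succ, iteratedDeriv_succ, iteratedDeriv_one,
    funext fun t => (h0 t).deriv, funext fun t => (h1 t).deriv, (h2 t).deriv]

lemma memLp_id_gaussianReal_natCast (k : ℕ) : MemLp (id : ℝ → ℝ) k (gaussianReal 0 1) := by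
  exact_mod_cast memLp_id_gaussianReal (μ := 0) (v := 1) k

lemma integrable_pow_gaussianReal (k : ℕ) : Integrable (fun x : ℝ => x ^ k) (gaussianReal 0 1) := by
  refine (integrable_norm_iff (by fun_prop)).1 ?_
  simpa using (memLp_id_gaussianReal_natCast k).integrable_norm_pow'

/-- The Gaussian is its own transform up to scaling, and its third derivative turns `s ^ 3` into the
Hermite polynomial `x ^ 3 - 3 x`. -/
lemma integral_oscExp_gaussianReal (κ x : ℝ) :
    ∫ s : ℝ, oscExp x s * (1 - I * κ * s ^ 3) ∂(gaussianReal 0 1)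
      = ((Real.exp (-(x ^ 2 / 2)) * (1 + κ * (x ^ 3 - 3 * x)) : ℝ) : ℂ) := by
  have hfun : charFun (gaussianReal 0 1) = fun t : ℝ => cexp (-(t ^ 2 / 2)) := by
    funext t
    rw [charFun_gaussianReal]
    congr 1
    simp
  have h0 : ∫ s, oscExp x s ∂(gaussianReal 0 1) = cexp (-(x ^ 2 / 2)) := by
    have := congrFun hfun (-x)
    rw [charFun_apply_real] at this
    simpa [oscExp, neg_mul] using this
  have h3 : ∫ s : ℝ, oscExp x s * s ^ 3 ∂(gaussianReal 0 1)
      = I * (x ^ 3 - 3 * x) * cexp (-(x ^ 2 / 2)) := by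
    have h := iteratedDeriv_charFun (t := -x) (memLp_id_gaussianReal_natCast 3)
    rw [hfun, iteratedDeriv_three_exp_neg_sq_div_two] at h
    have e : ∫ s : ℝ, (s : ℂ) ^ 3 * cexp ((-x : ℝ) * s * I) ∂(gaussianReal 0 1)
        = ∫ s : ℝ, oscExp x s * s ^ 3 ∂(gaussianReal 0 1) := by
      refine integral_congr_ae (ae_of_all _ fun s => ?_)
      simp only [oscExp]
      rw [mul_comm]
      congr 3
      push_cast
      ring
    rw [e] at h
    have hI : I * I ^ 3 = 1 := by rw [← pow_succ', I_pow_four]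
    rw [← one_mul (∫ s : ℝ, oscExp x s * s ^ 3 ∂(gaussianReal 0 1)), ← hI, mul_assoc, ← h]
    push_cast
    rw [neg_sq]
    ring
  have hint3 : Integrable (fun s : ℝ => oscExp x s * (s : ℂ) ^ 3) (gaussianReal 0 1) := by
    refine (integrable_pow_gaussianReal 3).mono
      ((continuous_oscExp x).mul (by fun_prop)).aestronglyMeasurable (ae_of_all _ fun s => ?_)
    simp
  have hint0 : Integrable (fun s : ℝ => oscExp x s) (gaussianReal 0 1) := by
    refine (integrable_const (1 : ℝ)).mono (continuous_oscExp x).aestronglyMeasurable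
      (ae_of_all _ fun s => ?_)
    simp
  have e : (fun s : ℝ => oscExp x s * (1 - I * κ * s ^ 3))
      = fun s : ℝ => oscExp x s - I * κ * (oscExp x s * s ^ 3) := by
    funext s; ring
  rw [e, integral_sub hint0 (hint3.const_mul _), integral_const_mul, h0, h3]
  push_cast
  linear_combination (-κ * (x ^ 3 - 3 * x) * cexp (-(x ^ 2 / 2))) * I_sq

lemma integral_oscExp_cell {r : ℝ} (hr : 0 < r) (z s : ℝ) :
    ∫ x in Set.Ioc (z - 1 / (2 * r)) (z + 1 / (2 * r)), oscExp x s
      = (r : ℂ)⁻¹ * (oscExp z s * charFun unitCell (s / r)) := by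
  have hle : z - 1 / (2 * r) ≤ z + 1 / (2 * r) := by
    have : 0 < 1 / (2 * r) := by positivity
    linarith
  rw [← intervalIntegral.integral_of_le hle, charFun_apply_real, unitCell,
    ← intervalIntegral.integral_of_le (by norm_num)]
  have h := intervalIntegral.integral_comp_sub_div (a := -(1 / 2)) (b := 1 / 2)
    (fun x => oscExp x s) hr.ne' z
  have e1 : z - 1 / 2 / r = z - 1 / (2 * r) := by field_simp
  have e2 : z - -(1 / 2) / r = z + 1 / (2 * r) := by field_simp; ring
  rw [e1, e2] at h
  have e3 : ∫ θ in (-(1 / 2) : ℝ)..(1 / 2), oscExp (z - θ / r) s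
      = oscExp z s * ∫ θ in (-(1 / 2) : ℝ)..(1 / 2), cexp ((s / r : ℝ) * θ * I) := by
    rw [← intervalIntegral.integral_const_mul]
    refine intervalIntegral.integral_congr fun θ _ => ?_
    simp only [oscExp]
    rw [← Complex.exp_add]
    congr 1
    push_cast
    ring
  have hrc : (r : ℂ) ≠ 0 := by exact_mod_cast hr.ne'
  rw [← e3, h, Complex.real_smul, ← mul_assoc, inv_mul_cancel₀ hrc, one_mul]

lemma setIntegral_gaussianReal_eq {s : Set ℝ} (hs : MeasurableSet s) (f : ℝ → ℝ) :
    ∫ x in s, f x ∂(gaussianReal 0 1) = ∫ x in s, gaussianPDFReal 0 1 x * f x := by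
  rw [← integral_indicator hs, integral_gaussianReal_eq_integral_smul one_ne_zero,
    ← integral_indicator hs]
  congr 1
  funext x
  by_cases hx : x ∈ s <;> simp [hx]

lemma gaussianPDFReal_zero_one (x : ℝ) :
    gaussianPDFReal 0 1 x = (√(2 * Real.pi))⁻¹ * Real.exp (-(x ^ 2 / 2)) := by
  simp [gaussianPDFReal, neg_div]

/-- The density is written as a Gaussian average of oscillations; Fubini integrates these over the
cell, and the frequency is rescaled by `s = r t`. The normalization `1 / √(2π)` occurs twice, once
for the density and once for the averaging measure, which yields `1 / (2π)`. -/
lemma setIntegral_hermite_gaussianReal {r : ℝ} (hr : 0 < r) (κ z : ℝ) :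
    ((∫ x in Set.Ioc (z - 1 / (2 * r)) (z + 1 / (2 * r)),
        (1 + κ * (x ^ 3 - 3 * x)) ∂(gaussianReal 0 1) : ℝ) : ℂ)
      = (2 * Real.pi : ℂ)⁻¹ * ∫ t : ℝ, oscExp (r * z) t * (charFun unitCell t *
        ((Real.exp (-(r ^ 2 * t ^ 2 / 2)) : ℂ) * (1 - I * κ * r ^ 3 * t ^ 3))) := by
  set S := Set.Ioc (z - 1 / (2 * r)) (z + 1 / (2 * r)) with hS
  set q := (√(2 * Real.pi))⁻¹ with hq
  have hqq : (q : ℂ) * q = (2 * Real.pi : ℂ)⁻¹ := by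
    rw [← ofReal_mul, hq, ← mul_inv, Real.mul_self_sqrt (by positivity)]
    push_cast
    rfl
  have hrc : (r : ℂ) ≠ 0 := by exact_mod_cast hr.ne'
  have hfin : IsFiniteMeasure (volume.restrict S) := ⟨by simp [hS]⟩
  have hcontK : Continuous (charFun unitCell) := continuous_charFun
  have hswap : Integrable (Function.uncurry fun (x : ℝ) (s : ℝ) =>
      oscExp x s * (1 - I * κ * s ^ 3)) ((volume.restrict S).prod (gaussianReal 0 1)) := by
    have h1 : Integrable (fun s : ℝ => 1 + |κ| * |s ^ 3|) (gaussianReal 0 1) :=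
      (integrable_const _).add ((integrable_pow_gaussianReal 3).abs.const_mul _)
    refine (h1.comp_snd (volume.restrict S)).mono ?_ (ae_of_all _ fun p => ?_)
    · refine Continuous.aestronglyMeasurable ?_
      unfold oscExp Function.uncurry
      fun_prop
    · simp only [Function.uncurry, norm_mul, norm_oscExp, one_mul]
      rw [Real.norm_of_nonneg (by positivity)]
      refine (norm_sub_le _ _).trans (le_of_eq ?_)
      simp
  calc ((∫ x in S, (1 + κ * (x ^ 3 - 3 * x)) ∂(gaussianReal 0 1) : ℝ) : ℂ)
      = ∫ x in S, (q : ℂ) * ∫ s : ℝ, oscExp x s * (1 - I * κ * s ^ 3) ∂(gaussianReal 0 1) := by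
        rw [setIntegral_gaussianReal_eq measurableSet_Ioc, ← integral_complex_ofReal]
        refine integral_congr_ae (ae_of_all _ fun x => ?_)
        simp only [integral_oscExp_gaussianReal, gaussianPDFReal_zero_one, ← hq]
        push_cast
        ring
    _ = q * ∫ s : ℝ, (∫ x in S, oscExp x s * (1 - I * κ * s ^ 3)) ∂(gaussianReal 0 1) := by
        rw [integral_const_mul, integral_integral_swap hswap]
    _ = q * ∫ s : ℝ, (r : ℂ)⁻¹ * (oscExp z s * charFun unitCell (s / r) * (1 - I * κ * s ^ 3))
          ∂(gaussianReal 0 1) := by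
        congr 1
        refine integral_congr_ae (ae_of_all _ fun s => ?_)
        simp only
        rw [integral_mul_const, hS, integral_oscExp_cell hr]
        ring
    _ = q * ((r : ℂ)⁻¹ * (q * ∫ s : ℝ, (fun s : ℝ => (Real.exp (-(s ^ 2 / 2)) : ℂ) *
          (oscExp z s * charFun unitCell (s / r) * (1 - I * κ * s ^ 3))) s)) := by
        rw [integral_const_mul, integral_gaussianReal_eq_integral_smul one_ne_zero,
          ← integral_const_mul (q : ℂ)]
        congr 3
        funext s
        rw [gaussianPDFReal_zero_one, ← hq, Complex.real_smul]
        push_cast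
        ring
    _ = q * ((r : ℂ)⁻¹ * (q * (r * ∫ t : ℝ, oscExp (r * z) t * (charFun unitCell t *
        ((Real.exp (-(r ^ 2 * t ^ 2 / 2)) : ℂ) * (1 - I * κ * r ^ 3 * t ^ 3)))))) := by
        congr 3
        have h := Measure.integral_comp_mul_left (fun s : ℝ => (Real.exp (-(s ^ 2 / 2)) : ℂ) *
          (oscExp z s * charFun unitCell (s / r) * (1 - I * κ * s ^ 3))) r
        rw [abs_of_pos (inv_pos.2 hr), Complex.real_smul, ofReal_inv] at h
        have h' : ∀ A B : ℂ, A = (r : ℂ)⁻¹ * B → B = r * A := by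
          rintro A B rfl
          rw [← mul_assoc, mul_inv_cancel₀ hrc, one_mul]
        rw [h' _ _ h]
        congr 1
        refine integral_congr_ae (ae_of_all _ fun t => ?_)
        simp only
        rw [mul_div_cancel_left₀ t hr.ne']
        have : oscExp z (r * t) = oscExp (r * z) t := by
          simp only [oscExp]; congr 3; ring
        rw [this, mul_pow r t 2]
        push_cast
        ring
    _ = _ := by
        rw [← hqq]
        field_simp

end GaussianInversion

/-! ### Truncation to `[-π, π]` and inversion on the lattice -/

section Inversion

open Complex

lemma integrable_edgeworthCharFun {b : ℝ} (hb : 0 < b) (α : ℝ) {n : ℕ} (hn : 1 ≤ n) :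
    Integrable (edgeworthCharFun b α n) := by
  have hn0 : (0 : ℝ) < n := by exact_mod_cast hn
  have hc : 0 < n * b / 2 := by positivity
  have h3 : Integrable fun t : ℝ => t ^ 3 * Real.exp (-(n * b / 2) * t ^ 2) := by
    refine (integrable_rpow_mul_exp_neg_mul_sq hc (s := 3) (by norm_num)).congr
      (ae_of_all _ fun t => ?_)
    simp only
    rw [show (3 : ℝ) = ((3 : ℕ) : ℝ) by norm_num, Real.rpow_natCast]
  have h0 := integrable_exp_neg_mul_sq hc
  refine (h0.add (h3.abs.const_mul (n * |α|))).mono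
    (continuous_edgeworthCharFun b α n).aestronglyMeasurable (ae_of_all _ fun t => ?_)
  refine (norm_edgeworthCharFun_le b α n t).trans ((le_of_eq ?_).trans (le_abs_self _))
  simp only [Pi.add_apply]
  rw [abs_mul, abs_pow, abs_of_pos (Real.exp_pos _),
    show -(n * b * t ^ 2 / 2) = -(n * b / 2) * t ^ 2 by ring]
  ring

/-- From `exp (-y) ≤ 6 / y ^ 3` with `y = n b t² / 2`: this gives `n⁻³`, one factor `n` is spent on
the cubic term, and an integrable majorant remains. -/
lemma exists_norm_edgeworthCharFun_le {b : ℝ} (hb : 0 < b) (α : ℝ) :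
    ∃ C, 0 ≤ C ∧ ∀ n : ℕ, 1 ≤ n → ∀ t : ℝ, 1 ≤ |t| →
      ‖edgeworthCharFun b α n t‖ ≤ C / n ^ 2 * (1 + t ^ 2)⁻¹ := by
  refine ⟨96 * (1 + |α|) / b ^ 3, by positivity, fun n hn t ht => ?_⟩
  have hn1 : (1 : ℝ) ≤ n := by exact_mod_cast hn
  have hn0 : (0 : ℝ) < n := by linarith
  refine (norm_edgeworthCharFun_le b α n t).trans ?_
  rw [← sq_abs t]
  set T := |t|
  have hT0 : 0 < T := by linarith
  have hx : 0 < n * b * T ^ 2 / 2 := by positivity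
  have h1 : Real.exp (-(n * b * T ^ 2 / 2)) ≤ 48 / (b ^ 3 * n ^ 3 * T ^ 6) := by
    have h := Real.pow_div_factorial_le_exp _ hx.le 3
    rw [Real.exp_neg, inv_le_comm₀ (Real.exp_pos _) (by positivity)]
    refine le_trans (le_of_eq ?_) h
    norm_num [Nat.factorial]
    field_simp
    norm_num
  have hT3 : (1 : ℝ) ≤ T ^ 3 := one_le_pow₀ ht
  have hT2 : (1 : ℝ) ≤ T ^ 2 := one_le_pow₀ ht
  have h2 : 1 + n * |α| * T ^ 3 ≤ (1 + |α|) * n * T ^ 3 := by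
    have : 1 ≤ n * T ^ 3 := by nlinarith
    linarith
  calc _ ≤ 48 / (b ^ 3 * n ^ 3 * T ^ 6) * ((1 + |α|) * n * T ^ 3) := by gcongr
    _ = 48 * (1 + |α|) / b ^ 3 / n ^ 2 * (T ^ 3)⁻¹ := by field_simp
    _ ≤ 48 * (1 + |α|) / b ^ 3 / n ^ 2 * (2 * (1 + T ^ 2)⁻¹) := by
        gcongr
        rw [← div_eq_mul_inv, inv_eq_one_div, div_le_div_iff₀ (by positivity) (by positivity)]
        nlinarith
    _ = _ := by ring

lemma exists_norm_integral_sub_le {b : ℝ} (hb : 0 < b) (α : ℝ) :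
    ∃ C, 0 ≤ C ∧ ∀ n : ℕ, 1 ≤ n → ∀ (k : ℝ → ℂ), Continuous k → (∀ t, ‖k t‖ ≤ 1) → ∀ y : ℝ,
      ‖(∫ t : ℝ, oscExp y t * (k t * edgeworthCharFun b α n t))
        - ∫ t in -Real.pi..Real.pi, oscExp y t * (k t * edgeworthCharFun b α n t)‖
        ≤ C / n ^ 2 := by
  have hpi := Real.pi_pos
  obtain ⟨C, hC0, hC⟩ := exists_norm_edgeworthCharFun_le hb α
  refine ⟨C * Real.pi, by positivity, fun n hn k hk hk1 y => ?_⟩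
  set F : ℝ → ℂ := fun t => oscExp y t * (k t * edgeworthCharFun b α n t) with hF
  have hFle : ∀ t, ‖F t‖ ≤ ‖edgeworthCharFun b α n t‖ := by
    intro t
    simp only [hF, norm_mul, norm_oscExp, one_mul]
    exact mul_le_of_le_one_left (norm_nonneg _) (hk1 t)
  have hFi : Integrable F := (integrable_edgeworthCharFun hb α hn).mono
    ((continuous_oscExp y).mul (hk.mul
      (continuous_edgeworthCharFun b α n))).aestronglyMeasurable (ae_of_all _ hFle)
  set S := Set.Ioc (-Real.pi) Real.pi with hS
  rw [intervalIntegral.integral_of_le (by linarith), ← integral_add_compl measurableSet_Ioc hFi,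
    add_sub_cancel_left]
  have hg : Integrable fun t : ℝ => C / n ^ 2 * (1 + t ^ 2)⁻¹ :=
    integrable_inv_one_add_sq.const_mul _
  calc ‖∫ t in Sᶜ, F t‖ ≤ ∫ t in Sᶜ, C / n ^ 2 * (1 + t ^ 2)⁻¹ := by
        refine norm_integral_le_of_norm_le hg.integrableOn ?_
        filter_upwards [ae_restrict_mem measurableSet_Ioc.compl] with t ht
        refine (hFle t).trans (hC n hn t ?_)
        have h3 := Real.pi_gt_three
        by_contra hcon
        have := abs_lt.1 (not_le.1 hcon)
        exact ht ⟨by linarith [this.1], by linarith [this.2]⟩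
    _ ≤ ∫ t, C / n ^ 2 * (1 + t ^ 2)⁻¹ :=
        setIntegral_le_integral hg (ae_of_all _ fun t => by positivity)
    _ = _ := by rw [integral_const_mul, integral_univ_inv_one_add_sq]; ring

lemma integral_cexp_int_mul (m : ℤ) :
    ∫ t in -Real.pi..Real.pi, cexp ((t * m : ℝ) * I) = if m = 0 then (2 * Real.pi : ℂ) else 0 := by
  split_ifs with hm
  · subst hm
    simp only [Int.cast_zero, mul_zero, ofReal_zero, zero_mul, Complex.exp_zero,
      intervalIntegral.integral_const, Complex.real_smul]
    push_cast
    ring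
  · have hc : (m : ℂ) * I ≠ 0 := mul_ne_zero (by exact_mod_cast hm) I_ne_zero
    have h := integral_exp_mul_complex (a := -Real.pi) (b := Real.pi) hc
    have e : ∀ t : ℝ, ((t * m : ℝ) : ℂ) * I = m * I * t := fun t => by push_cast; ring
    simp_rw [e]
    rw [h, div_eq_zero_iff]
    left
    rw [sub_eq_zero, Complex.exp_eq_exp_iff_exists_int]
    exact ⟨m, by push_cast; ring⟩

/-- Orthogonality of the characters on `[-π, π]`; the centering `θ` cancels between the two factors.
-/
lemma two_pi_mul_measureReal_singleton (ρ : Measure ℤ) [IsProbabilityMeasure ρ] (θ : ℝ) (k : ℤ) :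
    ((2 * Real.pi * ρ.real {k} : ℝ) : ℂ)
      = ∫ t in -Real.pi..Real.pi,
          oscExp (k - θ) t * charFun (ρ.map fun j : ℤ => (j : ℝ) - θ) t := by
  have hpi := Real.pi_pos
  have e1 : ∀ t : ℝ, oscExp (k - θ) t * charFun (ρ.map fun j : ℤ => (j : ℝ) - θ) t
      = ∫ j : ℤ, cexp ((t * (j - k : ℤ) : ℝ) * I) ∂ρ := by
    intro t
    rw [charFun_apply_real, integral_map (by fun_prop) (by fun_prop), ← integral_const_mul]
    refine integral_congr_ae (ae_of_all _ fun j => ?_)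
    simp only [oscExp]
    rw [← Complex.exp_add]
    congr 1
    push_cast
    ring
  simp_rw [e1]
  rw [intervalIntegral.integral_of_le (by linarith)]
  have hfin : IsFiniteMeasure (volume.restrict (Set.Ioc (-Real.pi) Real.pi)) := ⟨by simp⟩
  rw [integral_integral_swap]
  · have e2 : ∀ j : ℤ, ∫ t in Set.Ioc (-Real.pi) Real.pi, cexp ((t * (j - k : ℤ) : ℝ) * I)
        = Set.indicator {k} (fun _ => (2 * Real.pi : ℂ)) j := by
      intro j
      rw [← intervalIntegral.integral_of_le (by linarith), integral_cexp_int_mul]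
      simp [Set.indicator_apply, sub_eq_zero]
    simp_rw [e2]
    rw [integral_indicator (by measurability), setIntegral_const, Complex.real_smul]
    push_cast
    ring
  · refine (integrable_const (1 : ℝ)).mono ?_ (ae_of_all _ fun p => ?_)
    · refine Measurable.aestronglyMeasurable ?_
      unfold Function.uncurry
      fun_prop
    · simp only [Function.uncurry, norm_exp_ofReal_mul_I, norm_one, le_refl]

end Inversion

/-! ### The local Edgeworth expansion in `ℓ¹` -/

section LocalLimit

open Complex

lemma continuous_deriv_charFun {m : Measure ℝ} [IsProbabilityMeasure m]
    (h1 : Integrable (fun x : ℝ => x) m) :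
    Continuous fun t : ℝ => ∫ x : ℝ, I * x * cexp ((t * x : ℝ) * I) ∂m := by
  have hL : MemLp (id : ℝ → ℝ) (1 : ℕ) m := by
    rw [Nat.cast_one]; exact memLp_one_iff_integrable.2 h1
  have h := (contDiff_charFun hL).continuous_deriv (by simp)
  rwa [funext fun t => (hasDerivAt_charFun_of_integrable h1 t).deriv] at h

/-- Local Edgeworth expansion in total variation, restricted to `O(n)` lattice points. -/
theorem exists_sum_abs_measureReal_sub_le {m : Measure ℝ} [IsProbabilityMeasure m] {σ γ : ℝ}
    (hσ : 0 < σ) (h4 : Integrable (fun x : ℝ => x ^ 4) m) (h0 : ∫ x, x ∂m = 0)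
    (h2 : ∫ x, x ^ 2 ∂m = σ ^ 2) (h3 : ∫ x, x ^ 3 ∂m = σ ^ 3 * γ)
    (hlt : ∀ t, t ≠ 0 → |t| ≤ Real.pi → ‖charFun m t‖ < 1) :
    ∃ C, 0 ≤ C ∧ ∀ n : ℕ, 1 ≤ n → ∀ (ρ : Measure ℤ) [IsProbabilityMeasure ρ] (θ : ℝ),
      (∀ t, charFun (ρ.map fun j : ℤ => (j : ℝ) - θ) t = charFun m t ^ n) →
      ∀ s : Finset ℤ, (s.card : ℝ) ≤ 5 * n →
      ∑ k ∈ s, |ρ.real {k} - ∫ x in Set.Ioc ((k - θ) / (σ * √n) - 1 / (2 * (σ * √n)))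
          ((k - θ) / (σ * √n) + 1 / (2 * (σ * √n))),
          (1 + γ / (6 * √n) * (x ^ 3 - 3 * x)) ∂(gaussianReal 0 1)| ≤ C / n := by
  have hpi := Real.pi_pos
  have h1 : Integrable (fun x : ℝ => x) m := by
    simpa using integrable_pow_of_le (p := 1) (by norm_num) h4
  have h2i := integrable_pow_of_le (p := 2) (by norm_num) h4
  set b := σ ^ 2 with hb
  have hb0 : 0 < b := by positivity
  set α := σ ^ 3 * γ / 6 with hα
  set φ := charFun m with hφ
  set φ' : ℝ → ℂ := fun t => ∫ x : ℝ, I * x * cexp ((t * x : ℝ) * I) ∂m with hφ'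
  set k := charFun unitCell with hk
  set k' : ℝ → ℂ := fun t => ∫ x : ℝ, I * x * cexp ((t * x : ℝ) * I) ∂unitCell with hk'
  have hu1 : Integrable (fun x : ℝ => x) unitCell := integrable_unitCell continuous_id
  have hu2 : Integrable (fun x : ℝ => x ^ 2) unitCell := integrable_unitCell (continuous_pow 2)
  set v := ∫ x, x ^ 2 ∂unitCell
  have hv0 : 0 ≤ v := integral_nonneg fun x => sq_nonneg x
  obtain ⟨c₀, hc₀, hdecay⟩ := exists_norm_charFun_le_exp h4 h0 (by rw [h2]; exact hb0) hlt
  obtain ⟨M₁, hM₁, hcum⟩ := exists_norm_sub_cumulantExp_le (φ := φ) (φ' := φ') (b := b) (α := α)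
    (k := ∫ x, x ^ 4 ∂m) (R := Real.pi) hb0.le (integral_nonneg fun x => by positivity) hpi.le
    (fun t => by
      have h := norm_charFun_sub_le h4 h0 t
      rw [h2, h3] at h
      convert h using 3
      rw [hα]
      push_cast
      ring)
    (fun t => by
      have h := norm_deriv_charFun_sub_le h4 h0 t
      rw [h2, h3] at h
      convert h using 3
      rw [hα]
      push_cast
      ring)
  set M := M₁ + b + v with hM
  have hMle : M₁ ≤ M ∧ b ≤ M ∧ v ≤ M := by
    refine ⟨?_, ?_, ?_⟩ <;> rw [hM] <;> linarith
  obtain ⟨C₁, c', hC₁, hc', hbound⟩ := exists_edgeworth_bounds (φ := φ) (φ' := φ') (k := k)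
    (k' := k') (b := b) (α := α) (c := min c₀ (b / 2)) (M := M) (R := Real.pi)
    (lt_min hc₀ (by positivity)) (min_le_right _ _) (by positivity)
    (fun t ht => (hdecay t ht).trans (Real.exp_le_exp.2 (by
      have := min_le_left c₀ (b / 2)
      nlinarith [sq_nonneg t])))
    (fun t ht => ((hcum t ht).1).trans (by have := hMle.1; gcongr))
    (fun t _ => (norm_deriv_charFun_le h2i h0 t).trans (by
      rw [h2]; have := hMle.2.1; gcongr))
    (fun t ht => ((hcum t ht).2).trans (by have := hMle.1; gcongr))
    (fun t _ => (norm_charFun_sub_one_le hu2 integral_id_unitCell t).trans (by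
      have := hMle.2.2; gcongr))
    (fun t _ => (norm_deriv_charFun_le hu2 integral_id_unitCell t).trans (by
      have := hMle.2.2; gcongr))
  obtain ⟨C₂, hC₂, hsum⟩ := exists_sum_norm_integral_oscExp_le hC₁ hc'
  obtain ⟨C₃, hC₃, htail⟩ := exists_norm_integral_sub_le hb0 α
  -- `C₂` bounds the Fourier coefficients; `5 C₃` is the truncation error `C₃ / n²` over at most `5
  -- n` points.
  refine ⟨(2 * Real.pi)⁻¹ * (C₂ + 5 * C₃), by positivity, fun n hn ρ _ θ hρ s hs => ?_⟩
  have hn0 : (0 : ℝ) < n := by exact_mod_cast hn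
  set r := σ * √(n : ℝ) with hr
  have hsn : 0 < √(n : ℝ) := Real.sqrt_pos.2 hn0
  have hr0 : 0 < r := by positivity
  set G := edgeworthCharFun b α n with hG
  set f : ℝ → ℂ := fun t => φ t ^ n - k t * G t with hf
  have hderiv : ∀ t, HasDerivAt f (n * φ t ^ (n - 1) * φ' t
      - (k' t * G t + k t * edgeworthCharFunDeriv b α n t)) t := fun t =>
    ((hasDerivAt_charFun_of_integrable h1 t).pow n).sub
      ((hasDerivAt_charFun_of_integrable hu1 t).mul (hasDerivAt_edgeworthCharFun b α n t))
  have hφc : Continuous φ := continuous_charFun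
  have hkc : Continuous k := continuous_charFun
  have hGc : Continuous G := continuous_edgeworthCharFun b α n
  have hderivc : Continuous fun t => n * φ t ^ (n - 1) * φ' t
      - (k' t * G t + k t * edgeworthCharFunDeriv b α n t) := by
    have h1' : Continuous φ' := continuous_deriv_charFun h1
    have h2' : Continuous k' := continuous_deriv_charFun hu1
    have h3' := continuous_edgeworthCharFunDeriv b α n
    fun_prop
  have hmain := hsum n hn f _ hderiv hderivc (fun t ht => (hbound n hn t ht).1)
    (fun t ht => (hbound n hn t ht).2) θ s hs
  have hterm : ∀ j : ℤ, |ρ.real {j} - ∫ x in Set.Ioc ((j - θ) / r - 1 / (2 * r))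
          ((j - θ) / r + 1 / (2 * r)),
          (1 + γ / (6 * √n) * (x ^ 3 - 3 * x)) ∂(gaussianReal 0 1)|
      ≤ (2 * Real.pi)⁻¹ *
        (‖∫ t in -Real.pi..Real.pi, oscExp (j - θ) t * f t‖ + C₃ / n ^ 2) := by
    intro j
    have e1 := two_pi_mul_measureReal_singleton ρ θ j
    simp_rw [hρ] at e1
    have e2 := setIntegral_hermite_gaussianReal hr0 (γ / (6 * √n)) ((j - θ) / r)
    have e3 : ∀ t : ℝ, oscExp (r * ((j - θ) / r)) t * (charFun unitCell t *
        ((Real.exp (-(r ^ 2 * t ^ 2 / 2)) : ℂ) *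
          (1 - I * ((γ / (6 * √n) : ℝ) : ℂ) * r ^ 3 * t ^ 3)))
        = oscExp (j - θ) t * (k t * G t) := by
      intro t
      -- The scalings match: `r² = n b`, and the Hermite coefficient times `r³` is `n α`.
      have er : r ^ 2 = n * b := by rw [hr, mul_pow, Real.sq_sqrt hn0.le, mul_comm]
      have er3 : ((γ / (6 * √n) : ℝ) : ℂ) * r ^ 3 = n * α := by
        rw [← ofReal_pow, ← ofReal_mul, ← ofReal_natCast, ← ofReal_mul]
        congr 1
        rw [hr, hα, mul_pow]
        have : √(n : ℝ) ^ 3 = n * √(n : ℝ) := by rw [pow_succ, Real.sq_sqrt hn0.le]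
        rw [this]
        field_simp
      rw [mul_div_cancel₀ _ hr0.ne', er, hG, edgeworthCharFun, mul_assoc I, er3]
      congr 3
      ring
    simp_rw [e3] at e2
    have e4 : ∫ t in -Real.pi..Real.pi, oscExp (j - θ) t * f t
        = (∫ t in -Real.pi..Real.pi, oscExp (j - θ) t * φ t ^ n)
          - ∫ t in -Real.pi..Real.pi, oscExp (j - θ) t * (k t * G t) := by
      rw [← intervalIntegral.integral_sub]
      · simp only [hf, mul_sub]
      · exact (((continuous_oscExp _).mul (hφc.pow n)).intervalIntegrable _ _)
      · exact (((continuous_oscExp _).mul (hkc.mul hGc)).intervalIntegrable _ _)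
    have e5 := htail n hn k hkc (fun t => norm_charFun_le_one t) (j - θ)
    rw [← hG] at e5
    set J := ∫ t : ℝ, oscExp (j - θ) t * (k t * G t)
    set J₀ := ∫ t in -Real.pi..Real.pi, oscExp (j - θ) t * (k t * G t)
    set p := ∫ x in Set.Ioc ((j - θ) / r - 1 / (2 * r)) ((j - θ) / r + 1 / (2 * r)),
          (1 + γ / (6 * √n) * (x ^ 3 - 3 * x)) ∂(gaussianReal 0 1)
    have e6 : ((ρ.real {j} - p : ℝ) : ℂ) = (2 * Real.pi : ℂ)⁻¹ *
        ((∫ t in -Real.pi..Real.pi, oscExp (j - θ) t * f t) - (J - J₀)) := by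
      have hpc : (Real.pi : ℂ) ≠ 0 := by exact_mod_cast hpi.ne'
      rw [e4, ← e1, ofReal_sub, e2]
      push_cast
      field_simp
      ring
    rw [← Real.norm_eq_abs, ← norm_real, e6, norm_mul]
    have e7 : ‖(2 * Real.pi : ℂ)⁻¹‖ = (2 * Real.pi)⁻¹ := by
      rw [norm_inv, norm_mul, norm_real, Real.norm_of_nonneg hpi.le]; simp
    rw [e7]
    gcongr
    exact (norm_sub_le _ _).trans (add_le_add le_rfl e5)
  calc _ ≤ ∑ j ∈ s, (2 * Real.pi)⁻¹ *
        (‖∫ t in -Real.pi..Real.pi, oscExp (j - θ) t * f t‖ + C₃ / n ^ 2) :=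
        Finset.sum_le_sum fun j _ => hterm j
    _ = (2 * Real.pi)⁻¹ * (∑ j ∈ s, ‖∫ t in -Real.pi..Real.pi, oscExp (j - θ) t * f t‖
          + s.card * (C₃ / n ^ 2)) := by
        rw [← Finset.mul_sum, Finset.sum_add_distrib, Finset.sum_const, nsmul_eq_mul]
    _ ≤ (2 * Real.pi)⁻¹ * (C₂ / n + 5 * n * (C₃ / n ^ 2)) := by gcongr
    _ = _ := by field_simp

end LocalLimit

/-! ### From cell masses to test functions -/

section Assembly

lemma mem_cell_ceil {r : ℝ} (hr : 0 < r) (θ x : ℝ) :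
    x ∈ Set.Ioc ((((⌈r * x + θ - 1 / 2⌉ : ℤ) : ℝ) - θ) / r - 1 / (2 * r))
      ((((⌈r * x + θ - 1 / 2⌉ : ℤ) : ℝ) - θ) / r + 1 / (2 * r)) := by
  have h1 := Int.le_ceil (r * x + θ - 1 / 2)
  have h2 := Int.ceil_lt_add_one (r * x + θ - 1 / 2)
  set k : ℝ := ((⌈r * x + θ - 1 / 2⌉ : ℤ) : ℝ)
  have e1 : (k - θ) / r - 1 / (2 * r) = (k - θ - 1 / 2) / r := by field_simp
  have e2 : (k - θ) / r + 1 / (2 * r) = (k - θ + 1 / 2) / r := by field_simp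
  rw [e1, e2]
  refine ⟨?_, ?_⟩
  · rw [div_lt_iff₀ hr]; linarith
  · rw [le_div_iff₀ hr]; linarith

lemma pairwise_disjoint_cell {r : ℝ} (hr : 0 < r) (θ : ℝ) :
    Pairwise (Function.onFun Disjoint fun k : ℤ =>
      Set.Ioc ((k - θ) / r - 1 / (2 * r)) ((k - θ) / r + 1 / (2 * r))) := by
  intro i j hij
  refine Set.disjoint_left.2 fun x hi hj => hij ?_
  have e1 (k : ℤ) : (k - θ) / r - 1 / (2 * r) = (k - θ - 1 / 2) / r := by field_simp
  have e2 (k : ℤ) : (k - θ) / r + 1 / (2 * r) = (k - θ + 1 / 2) / r := by field_simp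
  rw [Set.mem_Ioc, e1, e2, div_lt_iff₀ hr, le_div_iff₀ hr] at hi hj
  have h1 : (i : ℝ) < j + 1 := by linarith [hi.1, hj.2]
  have h2 : (j : ℝ) < i + 1 := by linarith [hj.1, hi.2]
  have h1' : i < j + 1 := by exact_mod_cast h1
  have h2' : j < i + 1 := by exact_mod_cast h2
  omega

/-- Comparison of a lattice law with a signed density on a test function that is constant on the
cells of the atoms. -/
lemma abs_integral_sub_integral_le_of_cells {ρ : Measure ℤ} [IsProbabilityMeasure ρ]
    {τ : Measure ℝ} [IsProbabilityMeasure τ] [NullSingletonClass τ] {u : ℝ → ℝ}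
    (hu2 : Integrable (fun x => u x ^ 2) τ) (hu1 : Integrable u τ) {r θ N : ℝ} (hr : 0 < r)
    {h : ℝ → ℝ} (hmeas : AEMeasurable h τ) (hle : ∀ x, |h x| ≤ 1)
    (hconst : ∀ k : ℤ, ρ {k} ≠ 0 → ∃ c : ℝ, ∀ x ∈ Set.Ioo ((k - θ) / r - 1 / (2 * r))
      ((k - θ) / r + 1 / (2 * r)), h x = c)
    (s : Finset ℤ) (hs : ∀ k : ℤ, |k - θ| ≤ N + 1 → k ∈ s) :
    |(∫ k : ℤ, h ((k - θ) / r) ∂ρ) - ∫ x, (1 + u x) * h x ∂τ|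
      ≤ ∑ k ∈ s, |ρ.real {k} - ∫ x in Set.Ioc ((k - θ) / r - 1 / (2 * r))
          ((k - θ) / r + 1 / (2 * r)), (1 + u x) ∂τ|
        + 2 * ∫ x, u x ^ 2 ∂τ + ρ.real (s : Set ℤ)ᶜ
        + ∫ x in {x : ℝ | N < r * |x|}, |1 + u x| ∂τ := by
  set z : ℤ → ℝ := fun k => (k - θ) / r with hz
  set δ := 1 / (2 * r) with hδ
  have hδ0 : 0 < δ := by positivity
  set S : ℤ → Set ℝ := fun k => Set.Ioc (z k - δ) (z k + δ) with hS
  have hSm : ∀ k, MeasurableSet (S k) := fun k => measurableSet_Ioc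
  have h1u : Integrable (fun x => 1 + u x) τ := (integrable_const _).add hu1
  have hint : Integrable (fun x => (1 + u x) * h x) τ := by
    refine h1u.mono (h1u.aestronglyMeasurable.mul hmeas.aestronglyMeasurable)
      (ae_of_all _ fun x => ?_)
    rw [norm_mul]
    exact mul_le_of_le_one_right (norm_nonneg _) (hle x)
  have hH : Integrable (fun k : ℤ => h (z k)) ρ := by
    refine (integrable_const (1 : ℝ)).mono (measurable_of_countable _).aestronglyMeasurable
      (ae_of_all _ fun k => ?_)
    simpa using hle (z k)
  have hρ : ∫ k : ℤ, h (z k) ∂ρ = ∑ k ∈ s, ρ.real {k} * h (z k) + ∫ k in (s : Set ℤ)ᶜ, h (z k) ∂ρ := by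
    rw [← integral_add_compl s.measurableSet hH, setIntegral_finset _ hH.integrableOn]
    simp
  set U := ⋃ k ∈ s, S k with hU
  have hUm : MeasurableSet U := s.measurableSet_biUnion fun k _ => hSm k
  have hdisj : Set.Pairwise (s : Set ℤ) (Function.onFun Disjoint S) := fun i _ j _ hij =>
    pairwise_disjoint_cell hr θ hij
  have hτ : ∫ x, (1 + u x) * h x ∂τ
      = ∑ k ∈ s, ∫ x in S k, (1 + u x) * h x ∂τ + ∫ x in Uᶜ, (1 + u x) * h x ∂τ := by
    rw [← integral_add_compl hUm hint, hU,
      integral_biUnion_finset s (fun k _ => hSm k) hdisj fun _ _ => hint.integrableOn]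
  have hcell : ∀ k ∈ s, |ρ.real {k} * h (z k) - ∫ x in S k, (1 + u x) * h x ∂τ|
      ≤ |ρ.real {k} - ∫ x in S k, (1 + u x) ∂τ| + 2 * ∫ x in S k, u x ^ 2 ∂τ := by
    intro k _
    have hu0 : 0 ≤ ∫ x in S k, u x ^ 2 ∂τ := integral_nonneg fun x => sq_nonneg _
    by_cases hk : ρ {k} = 0
    -- No constancy of `h` is available here. Since `|1 + u| ≤ (1 + u) + 2 u²` for every real `u`,
    -- the cell contributes at most its signed mass, which is the local error because `ρ {k} = 0`,
    -- plus `2 ∫ u²`.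
    · have hk' : ρ.real {k} = 0 := by simp [Measure.real, hk]
      rw [hk', zero_mul, zero_sub, abs_neg, zero_sub, abs_neg]
      calc |∫ x in S k, (1 + u x) * h x ∂τ| ≤ ∫ x in S k, ((1 + u x) + 2 * u x ^ 2) ∂τ := by
            rw [← Real.norm_eq_abs]
            refine norm_integral_le_of_norm_le
              (g := fun x => (1 + u x) + 2 * u x ^ 2) (h1u.integrableOn.add (hu2.integrableOn.const_mul 2)) (ae_of_all _ fun x => ?_)
            rw [norm_mul]
            refine (mul_le_of_le_one_right (norm_nonneg _) (hle x)).trans ?_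
            rw [Real.norm_eq_abs, abs_le]
            constructor <;> nlinarith [sq_nonneg (u x + 1), sq_nonneg (u x)]
        _ = (∫ x in S k, (1 + u x) ∂τ) + 2 * ∫ x in S k, u x ^ 2 ∂τ := by
            rw [integral_add h1u.integrableOn (hu2.integrableOn.const_mul 2), integral_const_mul]
        _ ≤ _ := by gcongr; exact le_abs_self _
    · obtain ⟨c, hc⟩ := hconst k hk
      have hzk : h (z k) = c := hc (z k) ⟨by linarith, by linarith⟩
      have e : ∫ x in S k, (1 + u x) * h x ∂τ = (∫ x in S k, (1 + u x) ∂τ) * c := by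
        -- Constancy holds only on the open cell; the right endpoint is a null set.
        rw [← integral_mul_const, hS, ← setIntegral_congr_set Ioo_ae_eq_Ioc,
          ← setIntegral_congr_set Ioo_ae_eq_Ioc]
        exact setIntegral_congr_fun measurableSet_Ioo fun x hx => by rw [← hc x hx]
      rw [hzk, e, ← sub_mul, abs_mul]
      have hc1 : |c| ≤ 1 := hzk ▸ hle (z k)
      have := mul_le_of_le_one_right
        (abs_nonneg (ρ.real {k} - ∫ x in S k, (1 + u x) ∂τ)) hc1
      linarith
  have hρc : |∫ k in (s : Set ℤ)ᶜ, h (z k) ∂ρ| ≤ ρ.real (s : Set ℤ)ᶜ := by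
    have := norm_setIntegral_le_of_norm_le_const (μ := ρ) (s := (s : Set ℤ)ᶜ)
      (f := fun k => h (z k)) (C := 1) (measure_lt_top _ _) (fun k _ => hle (z k))
    simpa using this
  have hτc : |∫ x in Uᶜ, (1 + u x) * h x ∂τ| ≤ ∫ x in {x : ℝ | N < r * |x|}, |1 + u x| ∂τ := by
    calc _ ≤ ∫ x in Uᶜ, |1 + u x| ∂τ := by
          rw [← Real.norm_eq_abs]
          refine norm_integral_le_of_norm_le h1u.abs.integrableOn (ae_of_all _ fun x => ?_)
          rw [norm_mul]
          exact mul_le_of_le_one_right (norm_nonneg _) (hle x)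
      _ ≤ _ := by
          refine setIntegral_mono_set h1u.abs.integrableOn (ae_of_all _ fun x => abs_nonneg _)
            (LE.le.eventuallyLE fun x hx => ?_)
          -- If `r |x| ≤ N`, the index of the cell of `x` is within `N + 1 / 2` of `θ`, hence in
          -- `s`, and `x` would lie in `U`.
          by_contra hcon
          have hcon' : r * |x| ≤ N := not_lt.1 hcon
          refine hx (Set.mem_biUnion (hs ⌈r * x + θ - 1 / 2⌉ ?_) (mem_cell_ceil hr θ x))
          have h1 := Int.le_ceil (r * x + θ - 1 / 2)
          have h2 := Int.ceil_lt_add_one (r * x + θ - 1 / 2)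
          have h3 : |r * x| ≤ N := by rwa [abs_mul, abs_of_pos hr]
          have h4 := abs_le.1 h3
          exact abs_le.2 ⟨by linarith [h4.1], by linarith [h4.2]⟩
  have hsumu : ∑ k ∈ s, ∫ x in S k, u x ^ 2 ∂τ ≤ ∫ x, u x ^ 2 ∂τ := by
    rw [← integral_biUnion_finset s (fun k _ => hSm k) hdisj fun _ _ => hu2.integrableOn]
    exact setIntegral_le_integral hu2 (ae_of_all _ fun x => sq_nonneg _)
  have hsum : |∑ k ∈ s, (ρ.real {k} * h (z k) - ∫ x in S k, (1 + u x) * h x ∂τ)|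
      ≤ ∑ k ∈ s, |ρ.real {k} - ∫ x in S k, (1 + u x) ∂τ| + 2 * ∫ x, u x ^ 2 ∂τ := by
    refine (Finset.abs_sum_le_sum_abs _ _).trans ((Finset.sum_le_sum hcell).trans ?_)
    rw [Finset.sum_add_distrib, ← Finset.mul_sum]
    gcongr
  have e : (∫ k : ℤ, h (z k) ∂ρ) - ∫ x, (1 + u x) * h x ∂τ
      = ∑ k ∈ s, (ρ.real {k} * h (z k) - ∫ x in S k, (1 + u x) * h x ∂τ)
        + ((∫ k in (s : Set ℤ)ᶜ, h (z k) ∂ρ) - ∫ x in Uᶜ, (1 + u x) * h x ∂τ) := by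
    rw [hρ, hτ, Finset.sum_sub_distrib]; ring
  rw [e]
  refine (abs_add_le _ _).trans ?_
  have := abs_sub (∫ k in (s : Set ℤ)ᶜ, h (z k) ∂ρ) (∫ x in Uᶜ, (1 + u x) * h x ∂τ)
  linarith

end Assembly

/-! ### Moments, characteristic function and Chebyshev bound for the sum -/

section CenteredLaw

lemma integrable_sub_const_pow_four {ν : Measure ℤ} [IsProbabilityMeasure ν] (μ : ℝ)
    (h : Integrable (fun k : ℤ => (k : ℝ) ^ 4) ν) :
    Integrable (fun k : ℤ => ((k : ℝ) - μ) ^ 4) ν := by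
  refine ((h.const_mul 8).add (integrable_const (8 * μ ^ 4))).mono
    (measurable_of_countable _).aestronglyMeasurable (ae_of_all _ fun k => ?_)
  simp only [Pi.add_apply]
  rw [Real.norm_of_nonneg (by positivity), Real.norm_of_nonneg (by positivity)]
  nlinarith [sq_nonneg ((k : ℝ) ^ 2 - μ ^ 2), sq_nonneg (((k : ℝ) + μ) ^ 2),
    sq_nonneg (((k : ℝ) + μ) * (k - μ)), sq_nonneg ((k : ℝ) + μ), sq_nonneg ((k : ℝ) - μ)]

lemma integral_map_sub_const_pow (ν : Measure ℤ) (μ : ℝ) (p : ℕ) :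
    ∫ x, x ^ p ∂(ν.map fun k : ℤ => (k : ℝ) - μ) = ∫ k : ℤ, ((k : ℝ) - μ) ^ p ∂ν :=
  integral_map (by fun_prop) (by fun_prop)

variable {Ω : Type*} [MeasurableSpace Ω] {P : Measure Ω} {n : ℕ}
  {X : Fin n → Ω → ℤ} {ν : Measure ℤ}

lemma charFun_map_sum_sub [IsProbabilityMeasure P] (hX : ∀ i, HasLaw (X i) ν P)
    (hind : iIndepFun X P) (μ t : ℝ) :
    charFun ((P.map fun ω => ∑ i, X i ω).map fun j : ℤ => (j : ℝ) - n * μ) t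
      = charFun (ν.map fun k : ℤ => (k : ℝ) - μ) t ^ n := by
  have hXm : ∀ i, AEMeasurable (X i) P := fun i => (hX i).aemeasurable
  have hS : AEMeasurable (fun ω => ∑ i, X i ω) P := by fun_prop
  set g : ℤ → ℝ := fun k => (k : ℝ) - μ
  have hg : Measurable g := measurable_of_countable _
  have hY : ∀ i, AEMeasurable (g ∘ X i) P := fun i => hg.comp_aemeasurable (hXm i)
  have hYind : iIndepFun (fun i => g ∘ X i) P := hind.comp _ fun _ => hg
  have e : (P.map fun ω => ∑ i, X i ω).map (fun j : ℤ => (j : ℝ) - n * μ)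
      = P.map (fun ω => ∑ i, (g ∘ X i) ω) := by
    rw [AEMeasurable.map_map_of_aemeasurable (by fun_prop) hS]
    congr 1
    funext ω
    simp [g, Finset.sum_sub_distrib]
  rw [e, hYind.charFun_map_fun_sum_eq_prod hY, Finset.prod_apply]
  have : ∀ i, P.map (g ∘ X i) = ν.map g := fun i => by
    rw [← AEMeasurable.map_map_of_aemeasurable hg.aemeasurable (hXm i), (hX i).map_eq]
  simp [this]

lemma measureReal_le_abs_sum_sub_le [IsProbabilityMeasure P] (hX : ∀ i, HasLaw (X i) ν P)
    (hind : iIndepFun X P) {μ σ : ℝ} (h2 : MemLp (fun k : ℤ => (k : ℝ)) 2 ν)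
    (hmean : ∫ k : ℤ, (k : ℝ) ∂ν = μ) (hvar : Var[fun k : ℤ => (k : ℝ); ν] = σ ^ 2) (hn : 1 ≤ n) :
    P.real {ω | (n : ℝ) ≤ |((∑ i, X i ω : ℤ) : ℝ) - n * μ|} ≤ σ ^ 2 / n := by
  have hn0 : (0 : ℝ) < n := by exact_mod_cast hn
  set g : ℤ → ℝ := fun k => (k : ℝ) with hg
  have hgm : Measurable g := measurable_of_countable _
  have hXm : ∀ i, AEMeasurable (X i) P := fun i => (hX i).aemeasurable
  have hL : ∀ i, MemLp (g ∘ X i) 2 P := fun i => by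
    have : MemLp g 2 (P.map (X i)) := by rw [(hX i).map_eq]; exact h2
    exact this.comp_of_map (hXm i)
  have hYind : iIndepFun (fun i => g ∘ X i) P := hind.comp _ fun _ => hgm
  have hv : Var[∑ i, g ∘ X i; P] = n * σ ^ 2 := by
    rw [IndepFun.variance_sum (fun i _ => hL i) fun i _ j _ hij => hYind.indepFun hij]
    have : ∀ i, Var[g ∘ X i; P] = σ ^ 2 := fun i => by
      rw [← hvar, ← (hX i).map_eq, variance_map hgm.aemeasurable (hXm i)]
    simp [this]
  have hm : ∫ ω, (∑ i, g ∘ X i) ω ∂P = n * μ := by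
    have : ∀ i, ∫ ω, (g ∘ X i) ω ∂P = μ := fun i => by
      rw [← hmean, ← (hX i).integral_comp hgm.aestronglyMeasurable]
    simp only [Finset.sum_apply]
    rw [integral_finsetSum _ fun i _ => (hL i).integrable (by norm_num)]
    simp only [this]
    simp
  have h := meas_ge_le_variance_div_sq (memLp_finsetSum' Finset.univ fun i _ => hL i) hn0
  rw [hv, hm] at h
  have e : {ω | (n : ℝ) ≤ |((∑ i, X i ω : ℤ) : ℝ) - n * μ|}
      = {ω | (n : ℝ) ≤ |(∑ i, g ∘ X i) ω - n * μ|} := by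
    ext ω
    simp [hg]
  rw [e, Measure.real]
  refine (ENNReal.toReal_le_of_le_ofReal (by positivity) h).trans (le_of_eq ?_)
  field_simp

end CenteredLaw

/-! ### Gaussian tail and conclusion -/

section Main

lemma continuous_hermite_three : Continuous fun x : ℝ => x ^ 3 - 3 * x := by fun_prop

lemma integrable_hermite_three : Integrable (fun x : ℝ => x ^ 3 - 3 * x) (gaussianReal 0 1) := by
  have h1 := integrable_pow_gaussianReal 1
  simp only [pow_one] at h1
  exact (integrable_pow_gaussianReal 3).sub (h1.const_mul 3)

lemma integrable_hermite_three_sq :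
    Integrable (fun x : ℝ => (x ^ 3 - 3 * x) ^ 2) (gaussianReal 0 1) := by
  refine (((integrable_pow_gaussianReal 6).sub ((integrable_pow_gaussianReal 4).const_mul 6)).add
    ((integrable_pow_gaussianReal 2).const_mul 9)).congr (ae_of_all _ fun x => ?_)
  simp only [Pi.add_apply, Pi.sub_apply]
  ring

lemma integrable_sq_mul_one_add_abs_hermite_three (c : ℝ) :
    Integrable (fun x : ℝ => x ^ 2 * (1 + c * |x ^ 3 - 3 * x|)) (gaussianReal 0 1) := by
  have h : Integrable (fun x : ℝ => x ^ 2 * (x ^ 3 - 3 * x)) (gaussianReal 0 1) := by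
    refine ((integrable_pow_gaussianReal 5).sub
      ((integrable_pow_gaussianReal 3).const_mul 3)).congr (ae_of_all _ fun x => ?_)
    simp only [Pi.sub_apply]
    ring
  refine ((integrable_pow_gaussianReal 2).add (h.abs.const_mul c)).congr
    (ae_of_all _ fun x => ?_)
  simp only [Pi.add_apply]
  rw [abs_mul, abs_of_nonneg (sq_nonneg x)]
  ring

/-- Markov's inequality: on this set `σ² x² / n ≥ 1`. Bounding the coefficient by `|γ|` makes the
remaining integral independent of `n`. -/
lemma setIntegral_abs_one_add_hermite_le {σ γ : ℝ} (hσ : 0 < σ) {n : ℕ} (hn : 1 ≤ n) :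
    ∫ x in {x : ℝ | (n : ℝ) < σ * √n * |x|},
        |1 + γ / (6 * √n) * (x ^ 3 - 3 * x)| ∂(gaussianReal 0 1)
      ≤ σ ^ 2 * (∫ x : ℝ, x ^ 2 * (1 + |γ| * |x ^ 3 - 3 * x|) ∂(gaussianReal 0 1)) / n := by
  have hn1 : (1 : ℝ) ≤ n := by exact_mod_cast hn
  have hn0 : (0 : ℝ) < n := by linarith
  have hs1 : 1 ≤ √(n : ℝ) := Real.one_le_sqrt.2 hn1
  have hint := integrable_sq_mul_one_add_abs_hermite_three |γ|
  have hms : MeasurableSet {x : ℝ | (n : ℝ) < σ * √n * |x|} :=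
    measurableSet_lt measurable_const (by fun_prop)
  rw [mul_div_right_comm, ← integral_const_mul]
  refine le_trans ?_ (setIntegral_le_integral (s := {x : ℝ | (n : ℝ) < σ * √n * |x|})
    (hint.const_mul (σ ^ 2 / n)) (ae_of_all _ fun x => by positivity))
  refine setIntegral_mono_on ?_ (hint.const_mul _).integrableOn hms fun x hx => ?_
  · exact ((integrable_const (1 : ℝ)).add (integrable_hermite_three.const_mul _)).abs.integrableOn
  · have h1 : 1 ≤ σ ^ 2 / n * x ^ 2 := by
      have hx' : (n : ℝ) < σ * √n * |x| := hx
      have h2 : (n : ℝ) ^ 2 ≤ (σ * √n * |x|) ^ 2 := by gcongr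
      rw [mul_pow, mul_pow, Real.sq_sqrt hn0.le, sq_abs] at h2
      rw [div_mul_eq_mul_div, le_div_iff₀ hn0]
      nlinarith
    have h3 : |γ / (6 * √n)| ≤ |γ| := by
      rw [abs_div, abs_of_pos (by positivity : 0 < 6 * √(n : ℝ))]
      exact div_le_self (abs_nonneg _) (by linarith)
    have h4 : |1 + γ / (6 * √n) * (x ^ 3 - 3 * x)| ≤ 1 + |γ| * |x ^ 3 - 3 * x| := by
      refine (abs_add_le _ _).trans ?_
      rw [abs_one, abs_mul]
      gcongr
    calc _ ≤ 1 * (1 + |γ| * |x ^ 3 - 3 * x|) := by rwa [one_mul]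
      _ ≤ σ ^ 2 / n * x ^ 2 * (1 + |γ| * |x ^ 3 - 3 * x|) := by gcongr
      _ = _ := by ring

lemma mem_support_map_of_measure_preimage_ne_zero {Ω : Type*} [MeasurableSpace Ω] {P : Measure Ω}
    {W : Ω → ℝ} (hW : AEMeasurable W P) {z : ℝ} {A : Set Ω} (hA : P A ≠ 0)
    (hAW : ∀ ω ∈ A, W ω = z) : z ∈ (P.map W).support := by
  rw [Measure.mem_support_iff_forall]
  intro U hU
  refine (pos_iff_ne_zero.2 hA).trans_le ((measure_mono fun ω hω => ?_).trans
    (Measure.le_map_apply hW U))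
  rw [Set.mem_preimage, hAW ω hω]
  exact mem_of_mem_nhds hU

lemma card_Icc_ceil_floor_le (a b : ℝ) (hab : a ≤ b + 1) :
    ((Finset.Icc ⌈a⌉ ⌊b⌋).card : ℝ) ≤ b - a + 1 := by
  rw [Int.card_Icc]
  have h1 := Int.le_ceil a
  have h2 := Int.floor_le b
  have h3 : (((⌊b⌋ + 1 - ⌈a⌉).toNat : ℤ) : ℝ) ≤ b - a + 1 := by
    rw [Int.toNat_eq_max, Int.cast_max]
    push_cast
    exact max_le (by linarith) (by linarith)
  exact_mod_cast h3

/-- Measurability of `h` up to Gaussian null sets is Lebesgue measurability, since the Gaussian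
density is positive everywhere. -/
theorem theorem2 (ν : Measure ℤ) [IsProbabilityMeasure ν] (μ σ γ : ℝ) (hσ : 0 < σ)
    (hfourth : Integrable (fun k : ℤ => (k : ℝ) ^ 4) ν)
    (hmean : ∫ k : ℤ, (k : ℝ) ∂ν = μ)
    (hvar : Var[fun k : ℤ => (k : ℝ); ν] = σ ^ 2)
    (hskew : ∫ k : ℤ, ((k : ℝ) - μ) ^ 3 ∂ν = σ ^ 3 * γ)
    (s₀ : ℤ) (hs₀ : s₀ ∈ ν.support)
    (hgcd : Nat.setGcd {d : ℕ | ∃ s ∈ ν.support, d = (s - s₀).natAbs} = 1) :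
    ∃ C : ℝ, ∀ n : ℕ, 1 ≤ n →
      ∀ (Ω : Type*) [MeasurableSpace Ω] (P : Measure Ω) [IsProbabilityMeasure P]
        (X : Fin n → Ω → ℤ), (∀ i, HasLaw (X i) ν P) → iIndepFun X P →
      ∀ h : ℝ → ℝ, AEMeasurable h (gaussianReal 0 1) → (∀ x, |h x| ≤ 1) →
        ConstantAround h (P.map (standardizedSum μ σ X)).support (1 / (2 * σ * √(n : ℝ))) →
        |(∫ ω, h (standardizedSum μ σ X ω) ∂P) - (∫ z, h z ∂(gaussianReal 0 1))
            - γ / (6 * √(n : ℝ)) * ∫ z, (z ^ 3 - 3 * z) * h z ∂(gaussianReal 0 1)|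
          ≤ C / n := by
  set m := ν.map fun k : ℤ => (k : ℝ) - μ with hm
  have hmp : IsProbabilityMeasure m := Measure.isProbabilityMeasure_map (by fun_prop)
  have h4' : Integrable (fun x : ℝ => x ^ 4) m :=
    (integrable_map_measure (by fun_prop) (by fun_prop)).2
      (integrable_sub_const_pow_four μ hfourth)
  have hcast4 : MemLp (fun k : ℤ => (k : ℝ)) 4 ν := by
    refine (integrable_norm_rpow_iff (by fun_prop) (by norm_num) (by norm_num)).1 ?_
    refine hfourth.congr (ae_of_all _ fun k => ?_)
    norm_num
    rw [Even.pow_abs (by decide : Even 4)]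
  have hcast2 : MemLp (fun k : ℤ => (k : ℝ)) 2 ν := hcast4.mono_exponent (by norm_num)
  have h0 : ∫ x, x ∂m = 0 := by
    have h := integral_map_sub_const_pow ν μ 1
    simp only [pow_one] at h
    rw [hm, h, integral_sub (hcast2.integrable (by norm_num)) (integrable_const _), hmean]
    simp
  have h2 : ∫ x, x ^ 2 ∂m = σ ^ 2 := by
    rw [hm, integral_map_sub_const_pow, ← hvar, variance_eq_integral (by fun_prop), hmean]
  have h3 : ∫ x, x ^ 3 ∂m = σ ^ 3 * γ := by rw [hm, integral_map_sub_const_pow, hskew]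
  obtain ⟨C, hC0, hC⟩ := exists_sum_abs_measureReal_sub_le hσ h4' h0 h2 h3
    fun t ht htpi => norm_charFun_lt_one_of_setGcd_eq_one μ hs₀ hgcd ht htpi
  set H := ∫ x : ℝ, (x ^ 3 - 3 * x) ^ 2 ∂(gaussianReal 0 1) with hH
  set D := ∫ x : ℝ, x ^ 2 * (1 + |γ| * |x ^ 3 - 3 * x|) ∂(gaussianReal 0 1) with hD
  -- The four terms are the local expansion, the cells without an atom, Chebyshev's bound for the
  -- sum, and the Gaussian tail.
  refine ⟨C + 2 * (γ ^ 2 / 36 * H) + σ ^ 2 + σ ^ 2 * D, fun n hn Ω _ P _ X hX hind h hmeas hle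
    hconst => ?_⟩
  have hn1 : (1 : ℝ) ≤ n := by exact_mod_cast hn
  have hn0 : (0 : ℝ) < n := by linarith
  have hsn : 0 < √(n : ℝ) := Real.sqrt_pos.2 hn0
  set r := σ * √(n : ℝ) with hr
  have hr0 : 0 < r := by positivity
  set θ := (n : ℝ) * μ with hθ
  have hXm : ∀ i, AEMeasurable (X i) P := fun i => (hX i).aemeasurable
  set S : Ω → ℤ := fun ω => ∑ i, X i ω with hS
  have hSm : AEMeasurable S P := by fun_prop
  set ρ := P.map S with hρ
  have hρp : IsProbabilityMeasure ρ := Measure.isProbabilityMeasure_map hSm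
  have hWS : ∀ ω, standardizedSum μ σ X ω = ((S ω : ℝ) - θ) / r := by
    intro ω
    simp only [standardizedSum, hS, hθ, Finset.sum_sub_distrib, Finset.sum_const,
      Finset.card_univ, Fintype.card_fin, nsmul_eq_mul]
    push_cast
    rw [one_div, inv_mul_eq_div]
  have hWm : AEMeasurable (standardizedSum μ σ X) P := by
    rw [funext hWS]
    exact ((measurable_of_countable fun j : ℤ => ((j : ℝ) - θ) / r)).comp_aemeasurable hSm
  set u : ℝ → ℝ := fun x => γ / (6 * √n) * (x ^ 3 - 3 * x) with hu
  have hu1 : Integrable u (gaussianReal 0 1) := integrable_hermite_three.const_mul _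
  have hu2e : ∀ x, u x ^ 2 = γ ^ 2 / 36 / n * (x ^ 3 - 3 * x) ^ 2 := by
    intro x
    simp only [hu]
    rw [mul_pow, div_pow, mul_pow, Real.sq_sqrt hn0.le, div_div]
    norm_num
  have hu2 : Integrable (fun x => u x ^ 2) (gaussianReal 0 1) := by
    simp_rw [hu2e]
    exact integrable_hermite_three_sq.const_mul _
  have hu2i : ∫ x, u x ^ 2 ∂(gaussianReal 0 1) = γ ^ 2 / 36 * H / n := by
    simp_rw [hu2e]
    rw [integral_const_mul, hH]
    ring
  have hna : NullSingletonClass (gaussianReal 0 1) := nullSingletonClass_gaussianReal one_ne_zero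
  -- The window holds at most `2 n + 3 ≤ 5 n` integers, as `n ≥ 1`.
  set s := Finset.Icc ⌈θ - (n + 1)⌉ ⌊θ + (n + 1)⌋ with hs
  have hmem : ∀ k : ℤ, |(k : ℝ) - θ| ≤ n + 1 → k ∈ s := by
    intro k hk
    have hk' := abs_le.1 hk
    exact Finset.mem_Icc.2 ⟨Int.ceil_le.2 (by linarith [hk'.1]), Int.le_floor.2 (by linarith [hk'.2])⟩
  have hcard : (s.card : ℝ) ≤ 5 * n := by
    have := card_Icc_ceil_floor_le (θ - (n + 1)) (θ + (n + 1)) (by linarith)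
    rw [← hs] at this
    linarith
  have hδ : 1 / (2 * σ * √(n : ℝ)) = 1 / (2 * r) := by rw [hr, mul_assoc]
  have hcells : ∀ k : ℤ, ρ {k} ≠ 0 → ∃ c : ℝ, ∀ x ∈ Set.Ioo ((k - θ) / r - 1 / (2 * r))
      ((k - θ) / r + 1 / (2 * r)), h x = c := by
    intro k hk
    rw [← hδ]
    refine hconst _ (mem_support_map_of_measure_preimage_ne_zero hWm (A := S ⁻¹' {k}) ?_ ?_)
    · rwa [← Measure.map_apply_of_aemeasurable hSm (measurableSet_singleton k)]
    · intro ω hω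
      rw [hWS, Set.mem_singleton_iff.1 hω]
  have hmain := abs_integral_sub_integral_le_of_cells (ρ := ρ) (τ := gaussianReal 0 1) hu2 hu1
    (θ := θ) (N := n) hr0 hmeas hle hcells s hmem
  have hlocal := hC n hn ρ θ (fun t => charFun_map_sum_sub hX hind μ t) s hcard
  have htail : ρ.real (s : Set ℤ)ᶜ ≤ σ ^ 2 / n := by
    refine le_trans ?_ (measureReal_le_abs_sum_sub_le hX hind hcast2 hmean hvar hn)
    rw [measureReal_def, hρ, Measure.map_apply_of_aemeasurable hSm (by measurability)]
    refine ENNReal.toReal_mono (measure_ne_top _ _) (measure_mono fun ω hω => ?_)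
    by_contra hcon
    refine hω (hmem (S ω) ?_)
    have : |(S ω : ℝ) - θ| < n := not_le.1 hcon
    linarith
  have hgauss := setIntegral_abs_one_add_hermite_le (γ := γ) hσ hn
  have hi1 : Integrable h (gaussianReal 0 1) :=
    (integrable_const (1 : ℝ)).mono hmeas.aestronglyMeasurable
      (ae_of_all _ fun x => by simpa using hle x)
  have hi2 : Integrable (fun x => (x ^ 3 - 3 * x) * h x) (gaussianReal 0 1) := by
    refine integrable_hermite_three.mono
      (continuous_hermite_three.aestronglyMeasurable.mul hmeas.aestronglyMeasurable)
      (ae_of_all _ fun x => ?_)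
    rw [norm_mul]
    exact mul_le_of_le_one_right (norm_nonneg _) (hle x)
  have e1 : ∫ ω, h (standardizedSum μ σ X ω) ∂P = ∫ k : ℤ, h ((k - θ) / r) ∂ρ := by
    simp_rw [hWS]
    rw [hρ, integral_map hSm (measurable_of_countable _).aestronglyMeasurable]
  have e2 : ∫ x, (1 + u x) * h x ∂(gaussianReal 0 1) = (∫ z, h z ∂(gaussianReal 0 1))
      + γ / (6 * √(n : ℝ)) * ∫ z, (z ^ 3 - 3 * z) * h z ∂(gaussianReal 0 1) := by
    rw [← integral_const_mul, ← integral_add hi1 (hi2.const_mul _)]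
    refine integral_congr_ae (ae_of_all _ fun x => ?_)
    simp only [hu]
    ring
  rw [sub_sub, e1, ← e2]
  refine hmain.trans ?_
  rw [hu2i]
  calc _ ≤ C / n + 2 * (γ ^ 2 / 36 * H / n) + σ ^ 2 / n + σ ^ 2 * D / n := by
        gcongr
    _ = _ := by ring

end Main
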